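/- Conventions. Let $k\ge 0$. A $k$-graph is a countable small category $\Lambda$ (range and source maps $r,s$; $\mu\nu$ is defined when $s(\mu)=r(\nu)$; objects are identified with identity morphisms) with a functor $d:\Lambda\to\mathbb N^k$ such that for all $m,n\in\mathbb N^k$ every $\lambda\in\Lambda$ with $d(\lambda)=m+n$ is uniquely of the form $\lambda=\mu\nu$ with $d(\mu)=m$, $d(\nu)=n$. It is row-finite with no sources if for every object $v$ and $n\in\mathbb N^k$ the set $\{\lambda: r(\lambda)=v, d(\lambda)=n\}$ is finite and non-empty. $\Lambda^\infty$ is the set of degree-preserving functors $x$ from $\Omega_k=\{(m,n)\in\mathbb N^k\times\mathbb N^k:m\le n\}$ (objects $\mathbb N^k$, $r(m,n)=m$, $s(m,n)=n$, degree $n-m$) to $\Lambda$; $r(x)=x(0)$ and $(T^px)(m,n)=x(m+p,n+p)$. If $s(\lambda)=r(x)$, then $\lambda x$ is the unique $y\in\Lambda^\infty$ with $y(0,d(\lambda))=\lambda$ and $T^{d(\lambda)}y=x$. $\Lambda$ is cofinal if for all $x\in\Lambda^\infty$ and all objects $v$ there are $n\in\mathbb N^k$ and $\lambda\in\Lambda$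 with $r(\lambda)=v$, $s(\lambda)=x(n)$. $\mathcal G_\Lambda=\{(x,l-m,y)\in\Lambda^\infty\times\mathbb Z^k\times\Lambda^\infty: l,m\in\mathbb N^k,\ T^lx=T^my\}$ is the groupoid with $r(x,n,y)=x$, $s(x,n,y)=y$, $(x,n,y)(y,n',z)=(x,n+n',z)$ and units $(x,0,x)$, with the topology generated by the sets $Z(\mu,\nu)=\{(\mu x,d(\mu)-d(\nu),\nu x): x\in\Lambda^\infty,\ r(x)=s(\mu)\}$ for $s(\mu)=s(\nu)$. $\mathcal I_\Lambda$ is the interior of the isotropy $\{g\in\mathcal G_\Lambda: r(g)=s(g)\}$. Write $\mu\sim\nu$ if $s(\mu)=s(\nu)$ and $\mu x=\nu x$ for all $x\in\Lambda^\infty$ with $r(x)=s(\mu)$; $\operatorname{Per}(\Lambda)\subseteq\mathbb Z^k$ is the group $\{d(\mu)-d(\nu):\mu\sim\nu\}$ (taken to be $\{0\}$ if $\Lambda$ is empty). For cofinal $\Lambda$, $(x,p,x)\in\mathcal G_\Lambda$ for all $x\in\Lambda^\infty$, $p\in\operatorname{Per}(\Lambda)$. A $\mathbb T$-valued 2-cocycle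 on a small category (in particular on $\Lambda$, on a groupoid, or on a group) is a function $c$ from composable pairs to $\mathbb T$ with $c(\lambda,s(\lambda))=c(r(\lambda),\lambda)=1$ and $c(\mu,\nu)c(\lambda,\mu\nu)=c(\lambda,\mu)c(\lambda\mu,\nu)$. Two such functions $c,c'$ are cohomologous if $\overline{c(\mu,\nu)}c'(\mu,\nu)=b(\mu)b(\nu)\overline{b(\mu\nu)}$ for some $\mathbb T$-valued function $b$ on the morphisms that is $1$ on identities; on $\mathcal G_\Lambda$, cocycles and $b$ are required to be continuous. $Z^2(\cdot,\mathbb T)$ denotes the set of 2-cocycles (continuous ones for $\mathcal G_\Lambda$). A bicharacter of an abelian group $A$ is a map $A\times A\to\mathbb T$ that is a homomorphism in each variable. Statement. Let $\Lambda$ be a cofinal row-finite $k$-graph with no sources, and let $c\in Z^2(\Lambda,\mathbb T)$. Let $\mathcal P\subseteq\{(\mu,\nu)\in\Lambda\times\Lambda:s(\mu)=s(\nu)\}$ be such that $(\lambda,s(\lambda))\in\mathcal P$ for all $\lambda$ and $\mathcal G_\Lambda=\bigsqcup_{(\mu,\nu)\in\mathcal P}Z(\mu,\nu)$. For $g\in\mathcal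 G_\Lambda$ let $(\mu_g,\nu_g)$ be the element of $\mathcal P$ with $g\in Z(\mu_g,\nu_g)$. For composable $g,h\in\mathcal G_\Lambda$ there exist $\alpha,\beta,\gamma\in\Lambda$ and $y\in\Lambda^\infty$ with \[\nu_g\alpha=\mu_h\beta,\quad \mu_g\alpha=\mu_{gh}\gamma,\quad \nu_h\beta=\nu_{gh}\gamma,\] such that the first and last entries of $g$ are $\mu_g\alpha y,\ \nu_g\alpha y$, those of $h$ are $\mu_h\beta y,\ \nu_h\beta y$, and those of $gh$ are $\mu_{gh}\gamma y,\ \nu_{gh}\gamma y$; the value \[\sigma_c(g,h)=c(\mu_g,\alpha)\overline{c(\nu_g,\alpha)}\,c(\mu_h,\beta)\overline{c(\nu_h,\beta)}\,\overline{c(\mu_{gh},\gamma)}\,c(\nu_{gh},\gamma)\] does not depend on the choice of $\alpha,\beta,\gamma,y$, and $\sigma_c\in Z^2(\mathcal G_\Lambda,\mathbb T)$. For $x\in\Lambda^\infty$, the formula $\sigma_c^x(p,q)=\sigma_c((x,p,x),(x,q,x))$ defines an element of $Z^2(\operatorname{Per}(\Lambda),\mathbb T)$. Moreover: (1) There is a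 bicharacter $\omega$ of $\operatorname{Per}(\Lambda)$ such that $\sigma_c^x$ is cohomologous to $\omega$ for every $x\in\Lambda^\infty$. (2) $\mathcal I_\Lambda=\{(x,p,x):x\in\Lambda^\infty,\ p\in\operatorname{Per}(\Lambda)\}$, and for every bicharacter $\omega$ as in (1) there is $\sigma\in Z^2(\mathcal G_\Lambda,\mathbb T)$, cohomologous to $\sigma_c$, with $\sigma|_{\mathcal I_\Lambda}=\omega\times 1_{\Lambda^\infty}$, that is, $\sigma((x,p,x),(x,q,x))=\omega(p,q)$ for all $x\in\Lambda^\infty$ and $p,q\in\operatorname{Per}(\Lambda)$. -/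

import Mathlib

universe u

/-- A small category, with objects `Obj`, morphisms `Mor`, codomain (range) `r`, domain (source)
`s`; the composite `μν` is defined when `s μ = r ν`. -/
structure SmallCat where
  Obj : Type u
  Mor : Type u
  r : Mor → Obj
  s : Mor → Obj
  one : Obj → Mor
  comp : (μ ν : Mor) → s μ = r ν → Mor
  r_one : ∀ v, r (one v) = v
  s_one : ∀ v, s (one v) = v
  r_comp : ∀ μ ν h, r (comp μ ν h) = r μ
  s_comp : ∀ μ ν h, s (comp μ ν h) = s ν
  one_comp : ∀ μ, comp (one (r μ)) μ (s_one _) = μ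
  comp_one : ∀ μ, comp μ (one (s μ)) (r_one _).symm = μ
  assoc : ∀ μ ν ξ (h : s μ = r ν) (h' : s ν = r ξ),
    comp (comp μ ν h) ξ ((s_comp _ _ _).trans h') =
      comp μ (comp ν ξ h') (h.trans (r_comp _ _ _).symm)

namespace SmallCat

/-- Composable pairs of morphisms. -/
abbrev Pairs (C : SmallCat.{u}) : Type u := {p : C.Mor × C.Mor // C.s p.1 = C.r p.2}

/-- The composable pair `(μ, ν)`. -/
abbrev pair (C : SmallCat.{u}) (μ ν : C.Mor) (h : C.s μ = C.r ν) : C.Pairs := ⟨(μ, ν), h⟩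

/-- `c` is a (normalised) `𝕋`-valued 2-cocycle on the small category `C`. -/
structure IsCocycle (C : SmallCat.{u}) (c : C.Pairs → Circle) : Prop where
  right_one : ∀ μ, c (C.pair μ (C.one (C.s μ)) (C.r_one _).symm) = 1
  left_one : ∀ μ, c (C.pair (C.one (C.r μ)) μ (C.s_one _)) = 1
  cocycle : ∀ (l μ ν : C.Mor) (h : C.s l = C.r μ) (h' : C.s μ = C.r ν),
    c (C.pair μ ν h') * c (C.pair l (C.comp μ ν h') (h.trans (C.r_comp _ _ _).symm)) =
      c (C.pair l μ h) * c (C.pair (C.comp l μ h) ν ((C.s_comp _ _ _).trans h'))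

/-- The 2-coboundary `δ¹b (μ, ν) = b(μ) b(ν) conj(b(μν))`; on the circle group complex
conjugation is inversion. -/
noncomputable def coboundary (C : SmallCat.{u}) (b : C.Mor → Circle) : C.Pairs → Circle :=
  fun p => b p.1.1 * b p.1.2 * (b (C.comp p.1.1 p.1.2 p.2))⁻¹

/-- `c` and `c'` are cohomologous: `conj(c) c'` is the coboundary of some `b` which is `1` on all
identity morphisms. -/
def Cohomologous (C : SmallCat.{u}) (c c' : C.Pairs → Circle) : Prop :=
  ∃ b : C.Mor → Circle, (∀ v, b (C.one v) = 1) ∧ ∀ p, (c p)⁻¹ * c' p = C.coboundary b p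

/-- `c` and `c'` differ by the coboundary of a continuous `b` which is `1` on all identities. -/
def ContCohomologous (C : SmallCat.{u}) [TopologicalSpace C.Mor] (c c' : C.Pairs → Circle) :
    Prop :=
  ∃ b : C.Mor → Circle, Continuous b ∧ (∀ v, b (C.one v) = 1) ∧
    ∀ p, (c p)⁻¹ * c' p = C.coboundary b p

/-- An additive group, regarded as a category with one object. -/
def ofAddGroup (A : Type u) [AddGroup A] : SmallCat.{u} where
  Obj := PUnit
  Mor := A
  r _ := PUnit.unit
  s _ := PUnit.unit
  one _ := (0 : A)
  comp p q _ := (p + q : A)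
  r_one _ := rfl
  s_one _ := rfl
  r_comp _ _ _ := rfl
  s_comp _ _ _ := rfl
  one_comp := zero_add
  comp_one := add_zero
  assoc p q t _ _ := add_assoc p q t

end SmallCat

/-- A function of two variables on an abelian group `A`, seen as a 2-cochain on the one-object
category `A`. -/
def groupCochain {A : Type u} [AddCommGroup A] (ω : A → A → Circle) :
    (SmallCat.ofAddGroup A).Pairs → Circle :=
  fun p => ω p.1.1 p.1.2

/-- `ω` is a bicharacter of the abelian group `A`. -/
def IsBicharacter {A : Type u} [AddCommGroup A] (ω : A → A → Circle) : Prop :=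
  (∀ p p' q, ω (p + p') q = ω p q * ω p' q) ∧ (∀ p q q', ω p (q + q') = ω p q * ω p q')

/-- A `k`-graph: a countable small category with a degree functor to `ℕᵏ` having the
factorisation property. -/
structure KGraph (k : ℕ) extends SmallCat.{u} where
  countable : Countable Mor
  d : Mor → (Fin k → ℕ)
  d_one : ∀ v, d (one v) = 0
  d_comp : ∀ μ ν h, d (comp μ ν h) = d μ + d ν
  factor : ∀ (m n : Fin k → ℕ) (l : Mor), d l = m + n →
    ∃! p : toSmallCat.Pairs, d p.1.1 = m ∧ d p.1.2 = n ∧ comp p.1.1 p.1.2 p.2 = l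

namespace KGraph

variable {k : ℕ} (Λ : KGraph.{u} k)

/-- Row-finite with no sources: `0 < |vΛⁿ| < ∞` for all vertices `v` and all `n ∈ ℕᵏ`. -/
def RowFiniteNoSources : Prop :=
  ∀ (v : Λ.Obj) (n : Fin k → ℕ),
    {l : Λ.Mor | Λ.r l = v ∧ Λ.d l = n}.Finite ∧ {l : Λ.Mor | Λ.r l = v ∧ Λ.d l = n}.Nonempty

/-- An infinite path: a degree-preserving functor `x` from `Ω_k = {(m, n) : m ≤ n}` to `Λ`;
`vert n` is the value `x(n)` on objects and `seg m n` is the value `x(m, n)` on morphisms. -/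
structure InfPath where
  vert : (Fin k → ℕ) → Λ.Obj
  seg : (m n : Fin k → ℕ) → m ≤ n → Λ.Mor
  d_seg : ∀ m n h, Λ.d (seg m n h) = n - m
  r_seg : ∀ m n h, Λ.r (seg m n h) = vert m
  s_seg : ∀ m n h, Λ.s (seg m n h) = vert n
  seg_self : ∀ m, seg m m le_rfl = Λ.one (vert m)
  seg_comp : ∀ m n p (h : m ≤ n) (h' : n ≤ p),
    Λ.comp (seg m n h) (seg n p h') ((s_seg _ _ _).trans (r_seg _ _ _).symm) =
      seg m p (h.trans h')

/-- Cofinality: for every infinite path `x` and every vertex `v` there is `n` such that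
`v Λ x(n)` is not empty. -/
def IsCofinal : Prop :=
  ∀ (x : Λ.InfPath) (v : Λ.Obj), ∃ (n : Fin k → ℕ) (l : Λ.Mor), Λ.r l = v ∧ Λ.s l = x.vert n

variable {Λ}

theorem InfPath.ext_seg {x y : Λ.InfPath} (h : ∀ m n hmn, x.seg m n hmn = y.seg m n hmn) :
    x = y := by
  have hv : x.vert = y.vert := by
    funext m
    rw [← x.r_seg m m le_rfl, ← y.r_seg m m le_rfl, h]
  have hs : x.seg = y.seg := by
    funext m n hmn
    exact h m n hmn
  cases x
  cases y
  simp only at hv hs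
  subst hv hs
  rfl

/-- The range `r(x) = x(0)` of an infinite path. -/
def InfPath.range (x : Λ.InfPath) : Λ.Obj := x.vert 0

/-- The shift `(Tᵖ x)(m, n) = x(m + p, n + p)`. -/
def InfPath.shift (p : Fin k → ℕ) (x : Λ.InfPath) : Λ.InfPath where
  vert n := x.vert (n + p)
  seg m n h := x.seg (m + p) (n + p) (add_le_add_left h p)
  d_seg m n h := by rw [x.d_seg, add_tsub_add_eq_tsub_right]
  r_seg m n h := x.r_seg _ _ _
  s_seg m n h := x.s_seg _ _ _
  seg_self m := x.seg_self _
  seg_comp m n q h h' := x.seg_comp _ _ _ _ _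

theorem InfPath.shift_shift (p q : Fin k → ℕ) (x : Λ.InfPath) :
    (x.shift p).shift q = x.shift (p + q) := by
  apply InfPath.ext_seg
  intro m n h
  simp only [InfPath.shift]
  congr 1 <;> rw [add_assoc, add_comm q p]

theorem InfPath.shift_comm (p q : Fin k → ℕ) (x : Λ.InfPath) :
    (x.shift p).shift q = (x.shift q).shift p := by
  rw [shift_shift, shift_shift, add_comm]

theorem InfPath.shift_zero (x : Λ.InfPath) : x.shift 0 = x := by
  apply InfPath.ext_seg
  intro m n h
  simp only [InfPath.shift]
  congr 1

/-! ### Initial and final segments of finite paths -/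

theorem comp_inj {μ ν μ' ν' : Λ.Mor} (h : Λ.s μ = Λ.r ν) (h' : Λ.s μ' = Λ.r ν')
    (hd : Λ.d μ = Λ.d μ') (he : Λ.comp μ ν h = Λ.comp μ' ν' h') : μ = μ' ∧ ν = ν' := by
  have hd2 : Λ.d ν = Λ.d ν' := by
    have := congrArg Λ.d he
    rw [Λ.d_comp, Λ.d_comp, hd] at this
    exact add_left_cancel this
  obtain ⟨p, -, hp⟩ := Λ.factor (Λ.d μ') (Λ.d ν') _ (Λ.d_comp μ' ν' h')
  have h1 := hp ⟨(μ, ν), h⟩ ⟨hd, hd2, he⟩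
  have h2 := hp ⟨(μ', ν'), h'⟩ ⟨rfl, rfl, rfl⟩
  have h3 := congrArg Subtype.val (h1.trans h2.symm)
  exact ⟨congrArg Prod.fst h3, congrArg Prod.snd h3⟩

theorem eq_one_of_d_eq_zero {μ : Λ.Mor} (h : Λ.d μ = 0) : μ = Λ.one (Λ.r μ) :=
  (comp_inj (Λ.r_one _).symm (Λ.s_one _) (by rw [h, Λ.d_one])
    ((Λ.comp_one μ).trans (Λ.one_comp μ).symm)).1

theorem exists_split (μ : Λ.Mor) (n : Fin k → ℕ) (h : n ≤ Λ.d μ) :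
    ∃ (a b : Λ.Mor) (hab : Λ.s a = Λ.r b), Λ.d a = n ∧ Λ.comp a b hab = μ := by
  obtain ⟨p, ⟨h1, -, h3⟩, -⟩ := Λ.factor n (Λ.d μ - n) μ (add_tsub_cancel_of_le h).symm
  exact ⟨_, _, p.2, h1, h3⟩

/-- The initial segment `μ(0, n)` of a path `μ` with `n ≤ d(μ)`. -/
noncomputable def head (μ : Λ.Mor) (n : Fin k → ℕ) (h : n ≤ Λ.d μ) : Λ.Mor :=
  (exists_split μ n h).choose

/-- The final segment `μ(n, d(μ))` of a path `μ` with `n ≤ d(μ)`. -/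
noncomputable def tail (μ : Λ.Mor) (n : Fin k → ℕ) (h : n ≤ Λ.d μ) : Λ.Mor :=
  (exists_split μ n h).choose_spec.choose

theorem s_head (μ : Λ.Mor) (n : Fin k → ℕ) (h : n ≤ Λ.d μ) :
    Λ.s (head μ n h) = Λ.r (tail μ n h) :=
  (exists_split μ n h).choose_spec.choose_spec.choose

theorem d_head (μ : Λ.Mor) (n : Fin k → ℕ) (h : n ≤ Λ.d μ) : Λ.d (head μ n h) = n :=
  (exists_split μ n h).choose_spec.choose_spec.choose_spec.1

theorem head_comp_tail (μ : Λ.Mor) (n : Fin k → ℕ) (h : n ≤ Λ.d μ) :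
    Λ.comp (head μ n h) (tail μ n h) (s_head μ n h) = μ :=
  (exists_split μ n h).choose_spec.choose_spec.choose_spec.2

theorem d_tail (μ : Λ.Mor) (n : Fin k → ℕ) (h : n ≤ Λ.d μ) :
    Λ.d (tail μ n h) = Λ.d μ - n := by
  have := congrArg Λ.d (head_comp_tail μ n h)
  rw [Λ.d_comp, d_head] at this
  rw [← this, add_tsub_cancel_left]

theorem s_tail (μ : Λ.Mor) (n : Fin k → ℕ) (h : n ≤ Λ.d μ) : Λ.s (tail μ n h) = Λ.s μ := by
  have := congrArg Λ.s (head_comp_tail μ n h)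
  rwa [Λ.s_comp] at this

theorem r_head (μ : Λ.Mor) (n : Fin k → ℕ) (h : n ≤ Λ.d μ) : Λ.r (head μ n h) = Λ.r μ := by
  have := congrArg Λ.r (head_comp_tail μ n h)
  rwa [Λ.r_comp] at this

theorem split_unique {μ a b : Λ.Mor} {n : Fin k → ℕ} (h : n ≤ Λ.d μ) (hab : Λ.s a = Λ.r b)
    (hd : Λ.d a = n) (he : Λ.comp a b hab = μ) : head μ n h = a ∧ tail μ n h = b :=
  comp_inj _ _ ((d_head μ n h).trans hd.symm) ((head_comp_tail μ n h).trans he.symm)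

theorem head_comp {μ ν : Λ.Mor} (hc : Λ.s μ = Λ.r ν) {n : Fin k → ℕ} (h : n ≤ Λ.d μ)
    (h' : n ≤ Λ.d (Λ.comp μ ν hc)) : head (Λ.comp μ ν hc) n h' = head μ n h := by
  have h1 : Λ.s (tail μ n h) = Λ.r ν := (s_tail μ n h).trans hc
  refine (split_unique (b := Λ.comp (tail μ n h) ν h1) h'
    ((s_head μ n h).trans (Λ.r_comp _ _ _).symm) (d_head _ _ _) ?_).1
  rw [← Λ.assoc]
  congr 1
  exact head_comp_tail μ n h

theorem head_head {μ : Λ.Mor} {m n : Fin k → ℕ} (h : n ≤ Λ.d μ)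
    (hm : m ≤ Λ.d (head μ n h)) (hm' : m ≤ Λ.d μ) :
    head (head μ n h) m hm = head μ m hm' := by
  have key : ∀ (a : Λ.Mor) (ha : m ≤ Λ.d a), a = μ → head a m ha = head μ m hm' := by
    rintro a ha rfl
    rfl
  have h2 : m ≤ Λ.d (Λ.comp (head μ n h) (tail μ n h) (s_head μ n h)) := by
    rwa [head_comp_tail]
  rw [← head_comp (s_head μ n h) hm h2]
  exact key _ _ (head_comp_tail μ n h)

theorem head_congr {μ ν : Λ.Mor} (he : μ = ν) {m n : Fin k → ℕ} (hmn : m = n)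
    (h : m ≤ Λ.d μ) (h' : n ≤ Λ.d ν) : head μ m h = head ν n h' := by
  subst he hmn
  rfl

theorem tail_congr {μ ν : Λ.Mor} (he : μ = ν) {m n : Fin k → ℕ} (hmn : m = n)
    (h : m ≤ Λ.d μ) (h' : n ≤ Λ.d ν) : tail μ m h = tail ν n h' := by
  subst he hmn
  rfl

/-- The infinite path with prescribed coherent initial segments `x(0, n) = f n`. -/
noncomputable def InfPath.ofPrefix (f : (Fin k → ℕ) → Λ.Mor) (hd : ∀ n, Λ.d (f n) = n)
    (hf : ∀ m n (h : m ≤ n), head (f n) m (h.trans_eq (hd n).symm) = f m) : Λ.InfPath where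
  vert n := Λ.s (f n)
  seg m n h := tail (f n) m (h.trans_eq (hd n).symm)
  d_seg m n h := by rw [d_tail, hd]
  r_seg m n h := by rw [← s_head, hf m n h]
  s_seg m n h := s_tail _ _ _
  seg_self m := by
    have h0 : Λ.d (tail (f m) m (hd m).symm.le) = 0 := by rw [d_tail, hd, tsub_self]
    rw [eq_one_of_d_eq_zero h0, ← s_head, hf m m le_rfl]
  seg_comp m n p h h' := by
    have e1 := head_comp_tail (f p) n (h'.trans_eq (hd p).symm)
    have e2 := head_comp_tail (f n) m (h.trans_eq (hd n).symm)
    have hc : Λ.s (tail (f n) m (h.trans_eq (hd n).symm)) =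
        Λ.r (tail (f p) n (h'.trans_eq (hd p).symm)) := by
      rw [s_tail, ← s_head, hf n p h']
    refine (split_unique (a := head (f n) m (h.trans_eq (hd n).symm))
      ((h.trans h').trans_eq (hd p).symm)
      ((s_head _ _ _).trans (Λ.r_comp _ _ _).symm) (d_head _ _ _) ?_).2.symm
    rw [← Λ.assoc _ _ _ (s_head _ _ _) hc]
    refine Eq.trans ?_ e1
    congr 1
    rw [e2, hf n p h']

/-! ### The infinite path `λx` -/

/-- The path `l x(0, n)`. -/
def prepend (l : Λ.Mor) (x : Λ.InfPath) (hx : Λ.s l = x.range) (n : Fin k → ℕ) : Λ.Mor :=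
  Λ.comp l (x.seg 0 n zero_le) (hx.trans (x.r_seg _ _ _).symm)

theorem d_prepend (l : Λ.Mor) (x : Λ.InfPath) (hx : Λ.s l = x.range) (n : Fin k → ℕ) :
    Λ.d (prepend l x hx n) = Λ.d l + n := by
  rw [prepend, Λ.d_comp, x.d_seg, tsub_zero]

theorem s_prepend (l : Λ.Mor) (x : Λ.InfPath) (hx : Λ.s l = x.range) (n : Fin k → ℕ) :
    Λ.s (prepend l x hx n) = x.vert n := by
  rw [prepend, Λ.s_comp, x.s_seg]

theorem prepend_comp (l : Λ.Mor) (x : Λ.InfPath) (hx : Λ.s l = x.range) {m n : Fin k → ℕ}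
    (h : m ≤ n) :
    Λ.comp (prepend l x hx m) (x.seg m n h)
      ((s_prepend l x hx m).trans (x.r_seg _ _ _).symm) = prepend l x hx n := by
  unfold prepend
  rw [Λ.assoc _ _ _ _ ((x.s_seg _ _ _).trans (x.r_seg _ _ _).symm)]
  congr 1
  exact x.seg_comp _ _ _ _ _

theorem le_d_prepend (l : Λ.Mor) (x : Λ.InfPath) (hx : Λ.s l = x.range) (n : Fin k → ℕ) :
    n ≤ Λ.d (prepend l x hx n) := by
  rw [d_prepend]
  exact le_add_self

theorem head_prepend (l : Λ.Mor) (x : Λ.InfPath) (hx : Λ.s l = x.range) {m n q : Fin k → ℕ}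
    (h : m ≤ n) (hq : q ≤ Λ.d (prepend l x hx m)) (hq' : q ≤ Λ.d (prepend l x hx n)) :
    head (prepend l x hx n) q hq' = head (prepend l x hx m) q hq := by
  rw [← head_comp ((s_prepend l x hx m).trans (x.r_seg m n h).symm) hq
    (by rwa [prepend_comp l x hx h])]
  exact head_congr (prepend_comp l x hx h).symm rfl _ _

/-- The infinite path `l x`, for a path `l` and an infinite path `x` with `s(l) = r(x)`. -/
noncomputable def InfPath.concat (l : Λ.Mor) (x : Λ.InfPath) (hx : Λ.s l = x.range) :
    Λ.InfPath :=
  InfPath.ofPrefix (fun n => head (prepend l x hx n) n (le_d_prepend l x hx n))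
    (fun _ => d_head _ _ _)
    (fun m n h => by
      rw [head_head _ _ (h.trans (le_d_prepend l x hx n))]
      exact head_prepend l x hx h _ _)

theorem InfPath.shift_concat (l : Λ.Mor) (x : Λ.InfPath) (hx : Λ.s l = x.range) :
    (InfPath.concat l x hx).shift (Λ.d l) = x := by
  apply InfPath.ext_seg
  intro m n h
  have e1 : ∀ h', head (prepend l x hx (n + Λ.d l)) (n + Λ.d l) h' = prepend l x hx n := by
    intro h'
    have hq : n + Λ.d l ≤ Λ.d (prepend l x hx n) := by rw [d_prepend, add_comm]
    rw [head_prepend l x hx le_self_add hq]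
    exact (split_unique hq (Λ.r_one _).symm (by rw [d_prepend, add_comm])
      (Λ.comp_one (prepend l x hx n))).1
  have hm : m + Λ.d l ≤ Λ.d (prepend l x hx n) := by
    rw [d_prepend, add_comm]
    exact add_le_add_right h _
  have e2 := split_unique hm ((s_prepend l x hx m).trans (x.r_seg _ _ _).symm)
    (by rw [d_prepend, add_comm]) (prepend_comp l x hx h)
  have h0 : m + Λ.d l ≤ Λ.d (head (prepend l x hx (n + Λ.d l)) (n + Λ.d l) (le_d_prepend _ _ _ _)) := by
    rw [d_head]
    exact add_le_add_left h _
  exact (tail_congr (e1 _) rfl h0 hm).trans e2.2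

theorem InfPath.seg_concat (l : Λ.Mor) (x : Λ.InfPath) (hx : Λ.s l = x.range) :
    (InfPath.concat l x hx).seg 0 (Λ.d l) zero_le = l := by
  have e1 : head (prepend l x hx (Λ.d l)) (Λ.d l) (le_d_prepend l x hx _) = l :=
    (split_unique _ (hx.trans (x.r_seg _ _ _).symm) rfl rfl).1
  have e2 : tail l 0 zero_le = l :=
    (split_unique zero_le (Λ.s_one _) (Λ.d_one _) (Λ.one_comp l)).2
  exact (tail_congr e1 rfl zero_le zero_le).trans e2

/-- `λx` is the only infinite path `y` with `y(0, d(λ)) = λ` and `T^{d(λ)} y = x`. -/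
theorem InfPath.eq_concat (l : Λ.Mor) (x y : Λ.InfPath) (hx : Λ.s l = x.range)
    (h1 : y.seg 0 (Λ.d l) zero_le = l) (h2 : y.shift (Λ.d l) = x) :
    y = InfPath.concat l x hx := by
  have key : ∀ z : Λ.InfPath, z.seg 0 (Λ.d l) zero_le = l → z.shift (Λ.d l) = x →
      ∀ n, z.seg 0 (n + Λ.d l) zero_le = prepend l x hx n := by
    intro z hz1 hz2 n
    rw [← z.seg_comp 0 (Λ.d l) (n + Λ.d l) zero_le le_add_self]
    unfold prepend
    have hs : x.seg 0 n zero_le = z.seg (Λ.d l) (n + Λ.d l) le_add_self := by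
      subst hz2
      simp only [InfPath.shift]
      congr 1
      exact zero_add _
    congr 1
    exact hs.symm
  have big : ∀ z : Λ.InfPath, ∀ m n (h : m ≤ n) (h' : m ≤ Λ.d (z.seg 0 n zero_le)),
      z.seg m n h = tail (z.seg 0 n zero_le) m h' := fun z m n h h' =>
    (split_unique h' ((z.s_seg 0 m zero_le).trans (z.r_seg _ _ h).symm)
      (by rw [z.d_seg, tsub_zero]) (z.seg_comp 0 m n zero_le h)).2.symm
  have small : ∀ z : Λ.InfPath, ∀ n (h' : n ≤ Λ.d (z.seg 0 (n + Λ.d l) zero_le)),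
      z.seg 0 n zero_le = head (z.seg 0 (n + Λ.d l) zero_le) n h' := fun z n h' =>
    (split_unique h' ((z.s_seg _ _ _).trans (z.r_seg n _ le_self_add).symm)
      (by rw [z.d_seg, tsub_zero]) (z.seg_comp 0 n _ zero_le le_self_add)).1.symm
  have hle : ∀ (z : Λ.InfPath) (n : Fin k → ℕ), Λ.d (z.seg 0 n zero_le) = n :=
    fun z n => by rw [z.d_seg, tsub_zero]
  have pre : ∀ n, y.seg 0 n zero_le = (InfPath.concat l x hx).seg 0 n zero_le := by
    intro n
    rw [small y n (by rw [hle]; exact le_self_add),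
      small (InfPath.concat l x hx) n (by rw [hle]; exact le_self_add)]
    exact head_congr ((key y h1 h2 n).trans
      (key _ (seg_concat l x hx) (shift_concat l x hx) n).symm) rfl _ _
  apply InfPath.ext_seg
  intro m n h
  rw [big y m n h (by rwa [hle]), big (InfPath.concat l x hx) m n h (by rwa [hle])]
  exact tail_congr (pre n) rfl _ _

theorem InfPath.range_concat (l : Λ.Mor) (x : Λ.InfPath) (hx : Λ.s l = x.range) :
    (InfPath.concat l x hx).range = Λ.r l := by
  have h := (InfPath.concat l x hx).r_seg 0 (Λ.d l) zero_le
  rw [seg_concat] at h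
  exact h.symm

/-! ### The groupoid of a `k`-graph -/

variable (Λ)

/-- The difference `l - m ∈ ℤᵏ` of `l, m ∈ ℕᵏ`. -/
def zdiff {k : ℕ} (l m : Fin k → ℕ) : Fin k → ℤ := fun i => (l i : ℤ) - (m i : ℤ)

/-- The set underlying `𝒢_Λ`: triples `(x, l - m, y)` with `Tˡ x = Tᵐ y`. -/
def Gpd : Type u :=
  {t : Λ.InfPath × (Fin k → ℤ) × Λ.InfPath //
    ∃ l m : Fin k → ℕ, t.2.1 = zdiff l m ∧ t.1.shift l = t.2.2.shift m}

variable {Λ}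

/-- The first entry `x` of `(x, n, y)`. -/
def Gpd.fst (g : Λ.Gpd) : Λ.InfPath := g.1.1

/-- The middle entry `n` of `(x, n, y)`. -/
def Gpd.deg (g : Λ.Gpd) : Fin k → ℤ := g.1.2.1

/-- The last entry `y` of `(x, n, y)`. -/
def Gpd.snd (g : Λ.Gpd) : Λ.InfPath := g.1.2.2

theorem Gpd.ext' {g h : Λ.Gpd} (h1 : g.fst = h.fst) (h2 : g.deg = h.deg) (h3 : g.snd = h.snd) :
    g = h :=
  Subtype.ext (Prod.ext h1 (Prod.ext h2 h3))

variable (Λ)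

/-- The groupoid `𝒢_Λ` as a small category: `(x, p, y)(y, q, z) = (x, p + q, z)`; its object space
is `Λ^∞`, the unit at `x` being `(x, 0, x)`. -/
def gpd : SmallCat.{u} where
  Obj := Λ.InfPath
  Mor := Λ.Gpd
  r := Gpd.fst
  s := Gpd.snd
  one x := ⟨(x, 0, x), 0, 0, by funext i; simp [zdiff], rfl⟩
  comp g h hgh := ⟨(g.fst, g.deg + h.deg, h.snd), by
    obtain ⟨l, m, e1, e2⟩ := g.2
    obtain ⟨l', m', e1', e2'⟩ := h.2
    refine ⟨l + l', m + m', ?_, ?_⟩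
    · funext i
      have a1 := congrFun e1 i
      have a2 := congrFun e1' i
      simp only [zdiff] at a1 a2
      simp only [Pi.add_apply, Gpd.deg, zdiff, a1, a2]
      push_cast
      ring
    · change g.fst.shift l = g.snd.shift m at e2
      change h.fst.shift l' = h.snd.shift m' at e2'
      change g.fst.shift (l + l') = h.snd.shift (m + m')
      rw [← InfPath.shift_shift, e2, InfPath.shift_comm, hgh, e2', InfPath.shift_shift,
        add_comm]⟩
  r_one _ := rfl
  s_one _ := rfl
  r_comp _ _ _ := rfl
  s_comp _ _ _ := rfl
  one_comp g := Gpd.ext' rfl (zero_add _) rfl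
  comp_one g := Gpd.ext' rfl (add_zero _) rfl
  assoc _ _ _ _ _ := Gpd.ext' rfl (add_assoc _ _ _) rfl

/-- `Z(μ, ν) = {(μx, d(μ) - d(ν), νx) : x ∈ Λ^∞, r(x) = s(μ)}`, used when `s(μ) = s(ν)`. -/
def Z (μ ν : Λ.Mor) : Set Λ.gpd.Mor :=
  {g : Λ.Gpd | ∃ (x : Λ.InfPath) (hμ : Λ.s μ = x.range) (hν : Λ.s ν = x.range),
    g.fst = InfPath.concat μ x hμ ∧ g.deg = zdiff (Λ.d μ) (Λ.d ν) ∧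
      g.snd = InfPath.concat ν x hν}

/-- The topology on `𝒢_Λ` for which the sets `Z(μ, ν)` with `s(μ) = s(ν)` are a basis. -/
instance gpdTopology : TopologicalSpace Λ.gpd.Mor :=
  TopologicalSpace.generateFrom {U | ∃ μ ν, Λ.s μ = Λ.s ν ∧ U = Λ.Z μ ν}

/-- The isotropy of `𝒢_Λ`. -/
def isotropy : Set Λ.gpd.Mor := {g | Λ.gpd.r g = Λ.gpd.s g}

/-- `ℐ_Λ`, the interior of the isotropy of `𝒢_Λ`. -/
def isotropyInterior : Set Λ.gpd.Mor := interior Λ.isotropy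

/-! ### The periodicity group -/

/-- `μ ∼ ν`: `s(μ) = s(ν)`, and `μx = νx` for all infinite paths `x` with `r(x) = s(μ)`. -/
def Equi (μ ν : Λ.Mor) : Prop :=
  ∃ h : Λ.s μ = Λ.s ν, ∀ (x : Λ.InfPath) (hx : Λ.s μ = x.range),
    InfPath.concat μ x hx = InfPath.concat ν x (h.symm.trans hx)

/-- The set `{d(μ) - d(ν) : μ ∼ ν} ⊆ ℤᵏ`. -/
def perSet : Set (Fin k → ℤ) := {p | ∃ μ ν, Λ.Equi μ ν ∧ p = zdiff (Λ.d μ) (Λ.d ν)}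

/-- The group `Per(Λ)`. For cofinal `Λ` with an infinite path, the set `perSet` is already a
subgroup, so that taking the generated subgroup adds nothing: see `coe_per`. -/
def per : AddSubgroup (Fin k → ℤ) := AddSubgroup.closure Λ.perSet

variable {Λ}

/-- If `T^m` and `T^n` agree on `vΛ^∞`, they agree on `wΛ^∞` whenever `vΛw` is not empty. -/
theorem shift_eq_of_path {v : Λ.Obj} {m n : Fin k → ℕ}
    (hv : ∀ x : Λ.InfPath, x.range = v → x.shift m = x.shift n) (l : Λ.Mor) (hl : Λ.r l = v)
    (z : Λ.InfPath) (hz : Λ.s l = z.range) : z.shift m = z.shift n := by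
  have h := hv (InfPath.concat l z hz) ((InfPath.range_concat l z hz).trans hl)
  have h' := congrArg (InfPath.shift (Λ.d l)) h
  rwa [InfPath.shift_comm, InfPath.shift_concat, InfPath.shift_comm, InfPath.shift_concat] at h'

theorem Equi.shift_eq {μ ν : Λ.Mor} (h : Λ.Equi μ ν) (x : Λ.InfPath) (hx : x.range = Λ.s μ) :
    x.shift (Λ.d μ) = x.shift (Λ.d ν) := by
  obtain ⟨hs, hc⟩ := h
  have e := hc x hx.symm
  have e1 := InfPath.shift_concat μ x hx.symm
  have e2 := InfPath.shift_concat ν x (hs.symm.trans hx.symm)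
  rw [← e] at e2
  calc x.shift (Λ.d μ)
      = ((InfPath.concat μ x hx.symm).shift (Λ.d ν)).shift (Λ.d μ) := by rw [e2]
    _ = ((InfPath.concat μ x hx.symm).shift (Λ.d μ)).shift (Λ.d ν) := InfPath.shift_comm _ _ _
    _ = x.shift (Λ.d ν) := by rw [e1]

/-- For cofinal `Λ` and `p ∈ Per(Λ)`, the triple `(x, p, x)` is in `𝒢_Λ` for all `x`. -/
theorem exists_shift_of_mem_per (hcof : Λ.IsCofinal) (x : Λ.InfPath) {p : Fin k → ℤ}
    (hp : p ∈ Λ.per) : ∃ l m : Fin k → ℕ, p = zdiff l m ∧ x.shift l = x.shift m := by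
  refine AddSubgroup.closure_induction (p := fun p _ =>
    ∃ l m : Fin k → ℕ, p = zdiff l m ∧ x.shift l = x.shift m) ?_ ?_ ?_ ?_ hp
  · rintro p ⟨μ, ν, h, rfl⟩
    obtain ⟨n, l, hl, hn⟩ := hcof x (Λ.s μ)
    have hz : Λ.s l = (x.shift n).range := by
      rw [hn]
      exact congrArg x.vert (zero_add n).symm
    have e := shift_eq_of_path h.shift_eq l hl (x.shift n) hz
    rw [InfPath.shift_shift, InfPath.shift_shift] at e
    refine ⟨n + Λ.d μ, n + Λ.d ν, ?_, e⟩
    funext i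
    simp [zdiff]
  · exact ⟨0, 0, by funext i; simp [zdiff], rfl⟩
  · rintro p q - - ⟨l, m, rfl, e⟩ ⟨l', m', rfl, e'⟩
    refine ⟨l + l', m + m', ?_, ?_⟩
    · funext i
      simp only [zdiff, Pi.add_apply]
      push_cast
      ring
    · rw [← InfPath.shift_shift, e, InfPath.shift_comm, e', InfPath.shift_shift, add_comm]
  · rintro p - ⟨l, m, rfl, e⟩
    refine ⟨m, l, ?_, e.symm⟩
    funext i
    simp [zdiff]

theorem mem_perSet_iff (hrow : Λ.RowFiniteNoSources) (p : Fin k → ℤ) :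
    p ∈ Λ.perSet ↔ ∃ (v : Λ.Obj) (m n : Fin k → ℕ), p = zdiff m n ∧
      ∀ x : Λ.InfPath, x.range = v → x.shift m = x.shift n := by
  constructor
  · rintro ⟨μ, ν, h, rfl⟩
    exact ⟨Λ.s μ, _, _, rfl, h.shift_eq⟩
  · rintro ⟨v, m, n, rfl, h⟩
    obtain ⟨l, hl, hd⟩ := (hrow v (m + n)).2
    have hm : m ≤ Λ.d l := hd.symm ▸ le_self_add
    have hn : n ≤ Λ.d l := hd.symm ▸ le_add_self
    have hdm : Λ.d (tail l n hn) = m := by rw [d_tail, hd, add_tsub_cancel_right]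
    have hdn : Λ.d (tail l m hm) = n := by rw [d_tail, hd, add_tsub_cancel_left]
    have hcomp : ∀ (q : Fin k → ℕ) (hq : q ≤ Λ.d l) (x : Λ.InfPath) (hx : Λ.s l = x.range),
        (InfPath.concat l x hx).shift q =
          InfPath.concat (tail l q hq) x ((s_tail _ _ _).trans hx) := by
      intro q hq x hx
      have hq' : q + Λ.d (tail l q hq) = Λ.d l := by
        rw [d_tail, add_tsub_cancel_of_le hq]
      apply InfPath.eq_concat
      · have e := (InfPath.concat l x hx).seg_comp 0 q (Λ.d l) zero_le hq
        rw [InfPath.seg_concat] at e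
        have e2 := (split_unique hq _ (by rw [InfPath.d_seg, tsub_zero]) e).2
        rw [e2]
        simp only [InfPath.shift]
        congr 1
        · exact zero_add q
        · rw [← e2, add_comm, hq']
      · rw [InfPath.shift_shift, hq', InfPath.shift_concat]
    refine ⟨tail l n hn, tail l m hm, ⟨(s_tail _ _ _).trans (s_tail _ _ _).symm, ?_⟩, ?_⟩
    · intro x hx
      have hx' : Λ.s l = x.range := (s_tail l n hn).symm.trans hx
      rw [← hcomp n hn x hx', ← hcomp m hm x hx']
      exact (h _ ((InfPath.range_concat l x hx').trans hl)).symm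
    · rw [hdm, hdn]

/-- For cofinal `Λ` the set `{d(μ) - d(ν) : μ ∼ ν}` is the subgroup `Per(Λ)` itself. -/
theorem coe_per (hrow : Λ.RowFiniteNoSources) (hcof : Λ.IsCofinal) (x₀ : Λ.InfPath) :
    (Λ.per : Set (Fin k → ℤ)) = Λ.perSet := by
  apply Set.Subset.antisymm _ AddSubgroup.subset_closure
  intro p hp
  refine AddSubgroup.closure_induction (p := fun p _ => p ∈ Λ.perSet) (fun _ h => h) ?_ ?_ ?_ hp
  · exact (mem_perSet_iff hrow _).2
      ⟨x₀.vert 0, 0, 0, by funext i; simp [zdiff], fun _ _ => rfl⟩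
  · intro p q _ _ hp hq
    obtain ⟨v, m, n, rfl, h⟩ := (mem_perSet_iff hrow _).1 hp
    obtain ⟨w, m', n', rfl, h'⟩ := (mem_perSet_iff hrow _).1 hq
    obtain ⟨N, a, ha, haN⟩ := hcof x₀ v
    have hx : Λ.s a = (x₀.shift N).range := haN.trans (congrArg x₀.vert (zero_add N).symm)
    obtain ⟨M, b, hb, hbM⟩ := hcof (InfPath.concat a _ hx) w
    set y := InfPath.concat a _ hx with hy
    refine (mem_perSet_iff hrow _).2 ⟨y.vert M, m + m', n + n', ?_, ?_⟩
    · funext i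
      simp only [zdiff, Pi.add_apply]
      push_cast
      ring
    · intro z hz
      have e1 := shift_eq_of_path h (y.seg 0 M zero_le)
        ((y.r_seg _ _ _).trans ((InfPath.range_concat a _ hx).trans ha)) z
        ((y.s_seg _ _ _).trans hz.symm)
      have e2 := shift_eq_of_path h' b hb z (hbM.trans hz.symm)
      rw [← InfPath.shift_shift, e1, InfPath.shift_comm, e2, InfPath.shift_shift, add_comm]
  · intro p _ hp
    obtain ⟨v, m, n, rfl, h⟩ := (mem_perSet_iff hrow _).1 hp
    exact (mem_perSet_iff hrow _).2
      ⟨v, n, m, by funext i; simp [zdiff], fun x hx => (h x hx).symm⟩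

/-- The element `(x, p, x)` of `𝒢_Λ`, for `x ∈ Λ^∞` and `p ∈ Per(Λ)`. -/
def isoElt (hcof : Λ.IsCofinal) (x : Λ.InfPath) (p : Λ.per) : Λ.gpd.Mor :=
  ⟨(x, (p : Fin k → ℤ), x), exists_shift_of_mem_per hcof x p.2⟩

/-- The composable pair `((x, p, x), (x, q, x))`. -/
def isoPair (hcof : Λ.IsCofinal) (x : Λ.InfPath) (p q : Λ.per) : Λ.gpd.Pairs :=
  Λ.gpd.pair (isoElt hcof x p) (isoElt hcof x q) rfl

/-! ### The groupoid cocycle determined by a cocycle on `Λ` -/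

variable (Λ)

/-- `P ⊆ {(μ, ν) : s(μ) = s(ν)}` contains all `(λ, s(λ))`, and `𝒢_Λ` is the disjoint union of the
sets `Z(μ, ν)` with `(μ, ν) ∈ P`. -/
structure IsPartition (P : Set (Λ.Mor × Λ.Mor)) : Prop where
  source_eq : ∀ q ∈ P, Λ.s q.1 = Λ.s q.2
  base_mem : ∀ l : Λ.Mor, (l, Λ.one (Λ.s l)) ∈ P
  exists_unique : ∀ g : Λ.gpd.Mor, ∃! q : Λ.Mor × Λ.Mor, q ∈ P ∧ g ∈ Λ.Z q.1 q.2

/-- `g = (μ α y, d̃(g), ν α y)`. -/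
def Factors (g : Λ.Gpd) (μ ν α : Λ.Mor) (y : Λ.InfPath) : Prop :=
  ∃ (hμ : Λ.s μ = Λ.r α) (hν : Λ.s ν = Λ.r α) (hy : Λ.s α = y.range),
    g.fst = InfPath.concat (Λ.comp μ α hμ) y ((Λ.s_comp _ _ _).trans hy) ∧
      g.snd = InfPath.concat (Λ.comp ν α hν) y ((Λ.s_comp _ _ _).trans hy)

/-- Elements `α, β, γ ∈ Λ` and `y ∈ Λ^∞` adapted to a composable pair `(g, h)` in `𝒢_Λ`: with
`(μ_g, ν_g)` the element of `P` such that `g ∈ Z(μ_g, ν_g)`, and so on, one has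
`ν_g α = μ_h β`, `μ_g α = μ_{gh} γ`, `ν_h β = ν_{gh} γ`, `g = (μ_g α y, d̃(g), ν_g α y)`,
`h = (μ_h β y, d̃(h), ν_h β y)` and `gh = (μ_{gh} γ y, d̃(gh), ν_{gh} γ y)`. -/
structure Alignment (P : Set (Λ.Mor × Λ.Mor)) (gh : Λ.gpd.Pairs) where
  μg : Λ.Mor
  νg : Λ.Mor
  μh : Λ.Mor
  νh : Λ.Mor
  μgh : Λ.Mor
  νgh : Λ.Mor
  mem_g : (μg, νg) ∈ P ∧ gh.1.1 ∈ Λ.Z μg νg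
  mem_h : (μh, νh) ∈ P ∧ gh.1.2 ∈ Λ.Z μh νh
  mem_gh : (μgh, νgh) ∈ P ∧ Λ.gpd.comp gh.1.1 gh.1.2 gh.2 ∈ Λ.Z μgh νgh
  α : Λ.Mor
  β : Λ.Mor
  γ : Λ.Mor
  y : Λ.InfPath
  μg_α : Λ.s μg = Λ.r α
  νg_α : Λ.s νg = Λ.r α
  μh_β : Λ.s μh = Λ.r β
  νh_β : Λ.s νh = Λ.r β
  μgh_γ : Λ.s μgh = Λ.r γ
  νgh_γ : Λ.s νgh = Λ.r γ
  eq_gh : Λ.comp νg α νg_α = Λ.comp μh β μh_β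
  eq_left : Λ.comp μg α μg_α = Λ.comp μgh γ μgh_γ
  eq_right : Λ.comp νh β νh_β = Λ.comp νgh γ νgh_γ
  factors_g : Λ.Factors gh.1.1 μg νg α y
  factors_h : Λ.Factors gh.1.2 μh νh β y
  factors_gh : Λ.Factors (Λ.gpd.comp gh.1.1 gh.1.2 gh.2) μgh νgh γ y

variable {Λ}

/-- The product
`c(μ_g,α) conj(c(ν_g,α)) c(μ_h,β) conj(c(ν_h,β)) conj(c(μ_{gh},γ)) c(ν_{gh},γ)`. -/
noncomputable def Alignment.value {P : Set (Λ.Mor × Λ.Mor)} {gh : Λ.gpd.Pairs}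
    (A : Λ.Alignment P gh) (c : Λ.Pairs → Circle) : Circle :=
  c (Λ.pair A.μg A.α A.μg_α) * (c (Λ.pair A.νg A.α A.νg_α))⁻¹ *
    c (Λ.pair A.μh A.β A.μh_β) * (c (Λ.pair A.νh A.β A.νh_β))⁻¹ *
    (c (Λ.pair A.μgh A.γ A.μgh_γ))⁻¹ * c (Λ.pair A.νgh A.γ A.νgh_γ)

variable (Λ)

open Classical in
/-- The function `σ_c` on composable pairs of `𝒢_Λ`, computed from some choice of `α, β, γ, y`
(with the dummy value `1` if there were none). -/
noncomputable def sigmaC (P : Set (Λ.Mor × Λ.Mor)) (c : Λ.Pairs → Circle) :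
    Λ.gpd.Pairs → Circle :=
  fun gh => if h : Nonempty (Λ.Alignment P gh) then h.some.value c else 1

variable {Λ}

/-- For a 2-cochain `σ` on `𝒢_Λ` and `x ∈ Λ^∞`, the function
`σ^x(p, q) = σ((x, p, x), (x, q, x))` on `Per(Λ) × Per(Λ)`. -/
def fibre (hcof : Λ.IsCofinal) (σ : Λ.gpd.Pairs → Circle) (x : Λ.InfPath) :
    Λ.per → Λ.per → Circle :=
  fun p q => σ (isoPair hcof x p q)

end KGraph

/-! For g = (x, m - n, y) with w = T^m x = T^n y, consider the ratio c(x(0,m), w(0,q)) / c(y(0,n),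
w(0,q)). By the cocycle identity it is multiplicative as q grows (`theta_add`), and it is
multiplicative along products whose middle degrees match (`theta_comp`). Hence the proposed value of
σ_c depends only on the degrees of α, β, γ and is unchanged when all three grow by the same amount.
Any two choices have a common enlargement, so σ_c is well defined (`IsPartition.Adapted.weight_eq`).
Enlarging far enough lets a single degree serve each of f, g, h, fg, gh, fgh, and the cocycle
identity becomes a cancellation. Only finite initial segments enter, so σ_c is locally constant.

For the bicharacter, two facts about a free abelian group A are used: a symmetric cocycle is a
coboundary, because the abelian extension it defines splits; and, in finite rank, the
antisymmetrisation of any cocycle is bilinear, hence equals that of a bilinear map. It remains to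
see that the antisymmetrisation of σ_c^x does not depend on x. It is invariant under shifts, by
conjugation with (x, m, T^m x), and locally constant in x. By cofinality some path sharing a tail
with x lies arbitrarily close to any given y (`IsPartition.fibre_antisymm_eq`).

For the last claim, pointwise cochains relating σ_c^x to ω need not vary continuously with x. The
splitting argument is therefore repeated with coefficients in the group of locally constant
functions on Λ^∞. The resulting cochain lives on the interior of the isotropy, which is open and
also closed, so its extension by 1 is continuous and its coboundary corrects σ_c. -/

/-! ### Two-cocycles on free abelian groups -/

/-- A normalised 2-cocycle on an abelian group `A`, with values in an abelian group `M` written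
additively. -/
structure IsAddCocycle {A M : Type*} [AddCommGroup A] [AddCommGroup M] (f : A → A → M) :
    Prop where
  zero_left : ∀ p, f 0 p = 0
  zero_right : ∀ p, f p 0 = 0
  cocycle : ∀ p q t, f q t + f p (q + t) = f p q + f (p + q) t

namespace IsAddCocycle

variable {A M : Type*} [AddCommGroup A] [AddCommGroup M]

theorem of_bilin (ω : A →ₗ[ℤ] A →ₗ[ℤ] M) : IsAddCocycle fun p q => ω p q where
  zero_left p := by simp
  zero_right p := by simp
  cocycle p q t := by
    simp only [map_add, LinearMap.add_apply]
    abel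

theorem sub {f g : A → A → M} (hf : IsAddCocycle f) (hg : IsAddCocycle g) :
    IsAddCocycle fun p q => f p q - g p q where
  zero_left p := by rw [hf.zero_left, hg.zero_left, sub_zero]
  zero_right p := by rw [hf.zero_right, hg.zero_right, sub_zero]
  cocycle p q t := by
    have h1 := hf.cocycle p q t
    have h2 := hg.cocycle p q t
    linear_combination (norm := module) h1 - h2

/-- The abelian extension of `A` by `M` determined by a symmetric cocycle. -/
@[ext]
structure Extension {f : A → A → M} (hf : IsAddCocycle f) (hs : ∀ p q, f p q = f q p) where
  fst : M
  snd : A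

variable {f : A → A → M} (hf : IsAddCocycle f) (hs : ∀ p q, f p q = f q p)

instance : Add (Extension hf hs) := ⟨fun x y => ⟨x.fst + y.fst + f x.snd y.snd, x.snd + y.snd⟩⟩

instance : Zero (Extension hf hs) := ⟨⟨0, 0⟩⟩

instance : Neg (Extension hf hs) := ⟨fun x => ⟨-x.fst - f x.snd (-x.snd), -x.snd⟩⟩

theorem Extension.add_fst (x y : Extension hf hs) :
    (x + y).fst = x.fst + y.fst + f x.snd y.snd := rfl

theorem Extension.add_snd (x y : Extension hf hs) : (x + y).snd = x.snd + y.snd := rfl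

theorem Extension.zero_fst : (0 : Extension hf hs).fst = 0 := rfl

theorem Extension.zero_snd : (0 : Extension hf hs).snd = 0 := rfl

theorem Extension.neg_fst (x : Extension hf hs) : (-x).fst = -x.fst - f x.snd (-x.snd) := rfl

theorem Extension.neg_snd (x : Extension hf hs) : (-x).snd = -x.snd := rfl

/-- Associativity is the cocycle identity, the unit laws are normalisation, and commutativity is the
symmetry of `f`. -/
instance : AddCommGroup (Extension hf hs) where
  add_assoc x y z := by
    apply Extension.ext
    · simp only [Extension.add_fst, Extension.add_snd]
      have := hf.cocycle x.snd y.snd z.snd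
      linear_combination (norm := module) -this
    · simp only [Extension.add_snd, add_assoc]
  zero_add x := by
    apply Extension.ext
    · simp only [Extension.add_fst, Extension.zero_fst, Extension.zero_snd, hf.zero_left, zero_add,
        add_zero]
    · simp only [Extension.add_snd, Extension.zero_snd, zero_add]
  add_zero x := by
    apply Extension.ext
    · simp only [Extension.add_fst, Extension.zero_fst, Extension.zero_snd, hf.zero_right, add_zero]
    · simp only [Extension.add_snd, Extension.zero_snd, add_zero]
  add_comm x y := by
    apply Extension.ext
    · simp only [Extension.add_fst, hs x.snd y.snd, add_comm x.fst]
    · simp only [Extension.add_snd, add_comm]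
  neg_add_cancel x := by
    apply Extension.ext
    · simp only [Extension.add_fst, Extension.neg_fst, Extension.neg_snd, Extension.zero_fst,
        hs (-x.snd)]
      abel
    · simp only [Extension.add_snd, Extension.neg_snd, Extension.zero_snd, neg_add_cancel]
  nsmul := nsmulRec
  zsmul := zsmulRec

/-- The quotient map of the extension. -/
def Extension.proj : Extension hf hs →+ A where
  toFun x := x.snd
  map_zero' := rfl
  map_add' _ _ := rfl

/-- A symmetric 2-cocycle on a free abelian group is a coboundary. -/
theorem exists_eq_coboundary [Module.Free ℤ A] {f : A → A → M} (hf : IsAddCocycle f)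
    (hs : ∀ p q, f p q = f q p) :
    ∃ b : A → M, b 0 = 0 ∧ ∀ p q, f p q = b p + b q - b (p + q) := by
  -- A free group is projective, so the extension has an additive section; its `M`-component is
  -- minus the cochain sought.
  obtain ⟨s, hsec⟩ := Module.projective_lifting_property (Extension.proj hf hs).toIntLinearMap
    (LinearMap.id (R := ℤ) (M := A)) (fun a => ⟨⟨0, a⟩, rfl⟩)
  have h2 : ∀ p, (s p).snd = p := fun p => LinearMap.congr_fun hsec p
  refine ⟨fun p => -(s p).fst, ?_, fun p q => ?_⟩
  · simp only [map_zero, Extension.zero_fst, neg_zero]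
  · have h := congrArg Extension.fst (map_add s p q)
    rw [Extension.add_fst, h2, h2] at h
    simp only [h]
    abel

/-- The antisymmetrisation of a 2-cocycle is additive in the first variable. -/
theorem antisymm_add_left {f : A → A → M} (hf : IsAddCocycle f) (p p' q : A) :
    f (p + p') q - f q (p + p') = (f p q - f q p) + (f p' q - f q p') := by
  -- The three identities place `q` to the right of, to the left of, and between `p` and `p'`; their
  -- alternating sum leaves only the antisymmetrisations.
  have h1 := hf.cocycle p p' q
  have h2 := hf.cocycle q p p'
  have h3 := hf.cocycle p q p'
  rw [add_comm q p] at h2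
  rw [add_comm q p'] at h3
  linear_combination (norm := module) -h1 - h2 + h3

/-- The antisymmetrisation of a 2-cocycle, as a bilinear map. -/
def antisymm {f : A → A → M} (hf : IsAddCocycle f) : A →ₗ[ℤ] A →ₗ[ℤ] M :=
  (AddMonoidHom.mk' (fun p => (AddMonoidHom.mk' (fun q => f p q - f q p) (fun q q' => by
      have := hf.antisymm_add_left q q' p
      linear_combination (norm := module) -this)).toIntLinearMap)
    (fun p p' => LinearMap.ext fun q => hf.antisymm_add_left p p' q)).toIntLinearMap

theorem antisymm_apply {f : A → A → M} (hf : IsAddCocycle f) (p q : A) :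
    hf.antisymm p q = f p q - f q p := rfl

/-- The antisymmetrisation of a 2-cocycle on a free abelian group of finite rank is that of some
bilinear map. -/
theorem exists_bilin [Module.Free ℤ A] [Module.Finite ℤ A] {f : A → A → M}
    (hf : IsAddCocycle f) :
    ∃ ω : A →ₗ[ℤ] A →ₗ[ℤ] M, ∀ p q, ω p q - ω q p = f p q - f q p := by
  let e := Module.finBasis ℤ A
  -- The strictly upper triangular part of the alternating form: subtracting the transpose recovers
  -- the whole form, with no division by two.
  let ω : A →ₗ[ℤ] A →ₗ[ℤ] M := e.constr ℤ fun i => e.constr ℤ fun j =>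
    if i < j then hf.antisymm (e i) (e j) else 0
  have hω : ∀ i j, ω (e i) (e j) = if i < j then hf.antisymm (e i) (e j) else 0 := by
    intro i j
    simp only [ω, Module.Basis.constr_basis]
  have key : ω - ω.flip = hf.antisymm := by
    refine LinearMap.ext_basis e e fun i j => ?_
    rw [LinearMap.sub_apply, LinearMap.sub_apply, LinearMap.flip_apply, hω, hω]
    rcases lt_trichotomy i j with h | rfl | h
    · rw [if_pos h, if_neg h.asymm, sub_zero]
    · rw [antisymm_apply, sub_self, sub_self]
    · rw [if_neg h.asymm, if_pos h, antisymm_apply, antisymm_apply, zero_sub, neg_sub]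
  exact ⟨ω, fun p q => LinearMap.congr_fun₂ key p q⟩

end IsAddCocycle

/-! ### Subgroups of ℤᵏ are free of finite rank -/

theorem AddSubgroup.free_int_of_pi {k : ℕ} (H : AddSubgroup (Fin k → ℤ)) : Module.Free ℤ H :=
  Module.Free.of_equiv (LinearEquiv.refl ℤ (AddSubgroup.toIntSubmodule H))

theorem AddSubgroup.finite_int_of_pi {k : ℕ} (H : AddSubgroup (Fin k → ℤ)) : Module.Finite ℤ H :=
  Module.Finite.equiv (LinearEquiv.refl ℤ (AddSubgroup.toIntSubmodule H))

/-! ### Two-cocycles on small categories -/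

namespace SmallCat

open Classical in
/-- The value of a 2-cochain at `(μ, ν)`, with the dummy value `1` if `μν` is not defined. -/
noncomputable def val (C : SmallCat.{u}) (c : C.Pairs → Circle) (μ ν : C.Mor) : Circle :=
  if h : C.s μ = C.r ν then c (C.pair μ ν h) else 1

theorem val_eq {C : SmallCat.{u}} (c : C.Pairs → Circle) {μ ν : C.Mor} (h : C.s μ = C.r ν) :
    C.val c μ ν = c (C.pair μ ν h) := dif_pos h

theorem IsCocycle.val_cocycle {C : SmallCat.{u}} {c : C.Pairs → Circle} (hc : C.IsCocycle c)
    {l μ ν : C.Mor} (h : C.s l = C.r μ) (h' : C.s μ = C.r ν) :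
    C.val c μ ν * C.val c l (C.comp μ ν h') = C.val c l μ * C.val c (C.comp l μ h) ν := by
  rw [val_eq c h, val_eq c h', val_eq c (h.trans (C.r_comp _ _ _).symm),
    val_eq c ((C.s_comp _ _ _).trans h')]
  exact hc.cocycle l μ ν h h'

/-- For commuting pairs `(a, b)` and `(a', b')` of endomorphisms that are intertwined by `g`, the
ratio `σ(a, b) conj(σ(b, a))` does not change. -/
theorem IsCocycle.antisymm_conj {C : SmallCat.{u}} {σ : C.Pairs → Circle} (hσ : C.IsCocycle σ)
    {a b a' b' g : C.Mor} (hab : C.s a = C.r b) (hba : C.s b = C.r a)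
    (hab' : C.s a' = C.r b') (hba' : C.s b' = C.r a') (hag : C.s a = C.r g) (hbg : C.s b = C.r g)
    (hga : C.s g = C.r a') (hgb : C.s g = C.r b')
    (e : C.comp a b hab = C.comp b a hba) (e' : C.comp a' b' hab' = C.comp b' a' hba')
    (ea : C.comp a g hag = C.comp g a' hga) (eb : C.comp b g hbg = C.comp g b' hgb) :
    C.val σ a b * (C.val σ b a)⁻¹ = C.val σ a' b' * (C.val σ b' a')⁻¹ := by
  -- The first three identities give σ(a,b)/σ(a',b') = σ(a,g)σ(b,g)σ(g,a'b') /
  -- (σ(ab,g)σ(g,a')σ(g,b')). The right side is symmetric under exchanging (a,a') with (b,b'), and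
  -- the last three identities are the exchanged version.
  have h1 := hσ.val_cocycle hab hbg
  have h2 := hσ.val_cocycle hag hgb
  have h3 := hσ.val_cocycle hga hab'
  have h4 := hσ.val_cocycle hba hag
  have h5 := hσ.val_cocycle hbg hga
  have h6 := hσ.val_cocycle hgb hba'
  rw [eb] at h1
  rw [ea] at h2 h4
  rw [eb] at h5
  rw [← e] at h4
  rw [← e'] at h6
  apply_fun Additive.ofMul using Additive.ofMul.injective
  apply_fun Additive.ofMul at h1 h2 h3 h4 h5 h6
  simp only [ofMul_mul, ofMul_inv] at *
  grind

end SmallCat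

namespace KGraph

variable {k : ℕ} {Λ : KGraph.{u} k}

/-! ### Initial segments of infinite paths -/

/-- The initial segment `x(0, n)`. -/
def InfPath.initSeg (x : Λ.InfPath) (n : Fin k → ℕ) : Λ.Mor := x.seg 0 n zero_le

namespace InfPath

theorem d_initSeg (x : Λ.InfPath) (n : Fin k → ℕ) : Λ.d (x.initSeg n) = n := by
  rw [initSeg, x.d_seg, tsub_zero]

theorem r_initSeg (x : Λ.InfPath) (n : Fin k → ℕ) : Λ.r (x.initSeg n) = x.range := x.r_seg _ _ _

theorem range_shift (x : Λ.InfPath) (n : Fin k → ℕ) : (x.shift n).range = x.vert n :=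
  congrArg x.vert (zero_add n)

theorem s_initSeg (x : Λ.InfPath) (n : Fin k → ℕ) : Λ.s (x.initSeg n) = (x.shift n).range :=
  (x.s_seg _ _ _).trans (x.range_shift n).symm

theorem s_eq_r_initSeg (x : Λ.InfPath) (m n : Fin k → ℕ) :
    Λ.s (x.initSeg m) = Λ.r ((x.shift m).initSeg n) :=
  (x.s_initSeg m).trans ((x.shift m).r_initSeg n).symm

theorem initSeg_comp (x : Λ.InfPath) (m n : Fin k → ℕ) :
    Λ.comp (x.initSeg m) ((x.shift m).initSeg n) (x.s_eq_r_initSeg m n) = x.initSeg (m + n) := by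
  have h := x.seg_comp 0 m (m + n) zero_le le_self_add
  refine Eq.trans ?_ h
  congr 1
  simp only [initSeg, shift]
  congr 1
  · exact zero_add m
  · exact add_comm n m

theorem initSeg_concat (l : Λ.Mor) (x : Λ.InfPath) (hx : Λ.s l = x.range) :
    (concat l x hx).initSeg (Λ.d l) = l := seg_concat l x hx

theorem eq_concat_iff {l : Λ.Mor} {x y : Λ.InfPath} (hx : Λ.s l = x.range) :
    y = concat l x hx ↔ y.initSeg (Λ.d l) = l ∧ y.shift (Λ.d l) = x := by
  constructor
  · rintro rfl
    exact ⟨initSeg_concat l x hx, shift_concat l x hx⟩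
  · rintro ⟨h1, h2⟩
    exact eq_concat l x y hx h1 h2

theorem ext_initSeg {x y : Λ.InfPath} {n : Fin k → ℕ} (h : x.initSeg n = y.initSeg n)
    (h' : x.shift n = y.shift n) : x = y := by
  have hd := x.d_initSeg n
  have hr := x.s_initSeg n
  have hx : x = concat (x.initSeg n) (x.shift n) hr := by
    rw [eq_concat_iff, hd]
    exact ⟨rfl, rfl⟩
  rw [hx]
  symm
  rw [eq_concat_iff, hd]
  exact ⟨h.symm, h'.symm⟩

theorem initSeg_add_inj {x y : Λ.InfPath} {m n : Fin k → ℕ}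
    (h : x.initSeg (m + n) = y.initSeg (m + n)) :
    x.initSeg m = y.initSeg m ∧ (x.shift m).initSeg n = (y.shift m).initSeg n := by
  rw [← initSeg_comp, ← initSeg_comp] at h
  exact comp_inj _ _ (by rw [d_initSeg, d_initSeg]) h

theorem initSeg_mono {x y : Λ.InfPath} {m n : Fin k → ℕ} (hmn : m ≤ n)
    (h : x.initSeg n = y.initSeg n) : x.initSeg m = y.initSeg m := by
  obtain ⟨q, rfl⟩ := exists_add_of_le hmn
  exact (initSeg_add_inj h).1

theorem shift_add_eq {x y : Λ.InfPath} {m n : Fin k → ℕ} (h : x.shift m = y.shift n)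
    (q : Fin k → ℕ) : x.shift (m + q) = y.shift (n + q) := by
  rw [← shift_shift, h, shift_shift]

theorem shift_comp_initSeg {x : Λ.InfPath} {l ν : Λ.Mor} (h : Λ.s l = Λ.r ν)
    (hx : x.initSeg (Λ.d l + Λ.d ν) = Λ.comp l ν h) :
    x.initSeg (Λ.d l) = l ∧ (x.shift (Λ.d l)).initSeg (Λ.d ν) = ν := by
  rw [← initSeg_comp] at hx
  exact comp_inj _ _ (d_initSeg _ _) hx

end InfPath

/-! ### Elements of the path groupoid -/

/-- `g = (x, m - n, y)` with `T^m x = T^n y`. -/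
structure Gpd.Rep (g : Λ.Gpd) (m n : Fin k → ℕ) : Prop where
  deg : g.deg = zdiff m n
  shift : g.fst.shift m = g.snd.shift n

theorem Gpd.exists_rep (g : Λ.Gpd) : ∃ m n, g.Rep m n := by
  obtain ⟨m, n, h, h'⟩ := g.2
  exact ⟨m, n, h, h'⟩

theorem Gpd.Rep.add {g : Λ.Gpd} {m n : Fin k → ℕ} (h : g.Rep m n) (q : Fin k → ℕ) :
    g.Rep (m + q) (n + q) where
  deg := by
    rw [h.deg]
    funext i
    simp [zdiff]
  shift := InfPath.shift_add_eq h.shift q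

theorem Gpd.Rep.comp {g h : Λ.gpd.Mor} {m n l : Fin k → ℕ} (hg : Gpd.Rep g m n)
    (hh : Gpd.Rep h n l) (hc : Λ.gpd.s g = Λ.gpd.r h) : Gpd.Rep (Λ.gpd.comp g h hc) m l where
  deg := by
    change Gpd.deg g + Gpd.deg h = _
    rw [hg.deg, hh.deg]
    funext i
    simp [zdiff]
  shift := by
    change (Gpd.fst g).shift m = (Gpd.snd h).shift l
    rw [← hh.shift, hg.shift]
    exact congrArg _ hc

/-- Replaces the existential description of `Z μ ν` by equations between initial segments, so that
later arguments concern degrees only. -/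
theorem mem_Z_iff {g : Λ.gpd.Mor} {μ ν : Λ.Mor} :
    g ∈ Λ.Z μ ν ↔ (Gpd.fst g).initSeg (Λ.d μ) = μ ∧ (Gpd.snd g).initSeg (Λ.d ν) = ν ∧
      Gpd.Rep g (Λ.d μ) (Λ.d ν) := by
  constructor
  · rintro ⟨x, hμ, hν, h1, h2, h3⟩
    rw [InfPath.eq_concat_iff] at h1 h3
    exact ⟨h1.1, h3.1, h2, h1.2.trans h3.2.symm⟩
  · rintro ⟨h1, h2, h3⟩
    have e1 : Λ.s μ = ((Gpd.fst g).shift (Λ.d μ)).range := by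
      rw [← InfPath.s_initSeg, h1]
    have e2 : Λ.s ν = ((Gpd.fst g).shift (Λ.d μ)).range := by
      rw [h3.shift, ← InfPath.s_initSeg, h2]
    exact ⟨_, e1, e2, (InfPath.eq_concat_iff _).2 ⟨h1, rfl⟩, h3.deg,
      (InfPath.eq_concat_iff _).2 ⟨h2, h3.shift.symm⟩⟩

/-- The ratio `c(x(0,m), w(0,q)) conj(c(y(0,n), w(0,q)))` with `w = T^m x`, for an element
`g = (x, m - n, y)` with `T^m x = T^n y`. -/
noncomputable def theta (c : Λ.Pairs → Circle) (g : Λ.Gpd) (m n q : Fin k → ℕ) : Circle :=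
  Λ.val c (g.fst.initSeg m) ((g.fst.shift m).initSeg q) *
    (Λ.val c (g.snd.initSeg n) ((g.fst.shift m).initSeg q))⁻¹

theorem val_initSeg_add {c : Λ.Pairs → Circle} (hc : Λ.IsCocycle c) (x : Λ.InfPath)
    (m a b : Fin k → ℕ) :
    Λ.val c ((x.shift m).initSeg a) ((x.shift (m + a)).initSeg b) *
        Λ.val c (x.initSeg m) ((x.shift m).initSeg (a + b)) =
      Λ.val c (x.initSeg m) ((x.shift m).initSeg a) *
        Λ.val c (x.initSeg (m + a)) ((x.shift (m + a)).initSeg b) := by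
  have h := hc.val_cocycle (x.s_eq_r_initSeg m a) ((x.shift m).s_eq_r_initSeg a b)
  rwa [InfPath.initSeg_comp, InfPath.initSeg_comp, InfPath.shift_shift] at h

/-- The cocycle identity is applied along both entries of `g`. Their tails coincide, so the factor
involving only the tail cancels in the ratio. -/
theorem theta_add {c : Λ.Pairs → Circle} (hc : Λ.IsCocycle c) {g : Λ.Gpd} {m n : Fin k → ℕ}
    (hg : g.Rep m n) (a b : Fin k → ℕ) :
    theta c g m n (a + b) = theta c g m n a * theta c g (m + a) (n + a) b := by
  have h1 := val_initSeg_add hc g.fst m a b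
  have h2 := val_initSeg_add hc g.snd n a b
  rw [← hg.shift, ← (hg.add a).shift] at h2
  unfold theta
  apply_fun Additive.ofMul using Additive.ofMul.injective
  apply_fun Additive.ofMul at h1 h2
  simp only [ofMul_mul, ofMul_inv] at *
  grind

/-- The denominator for `g` and the numerator for `h` are the same value of `c`, because the middle
degree `n` is shared. -/
theorem theta_comp (c : Λ.Pairs → Circle) {g h : Λ.gpd.Mor} {m n l : Fin k → ℕ}
    (hg : Gpd.Rep g m n) (hc : Λ.gpd.s g = Λ.gpd.r h) (q : Fin k → ℕ) :
    theta c (Λ.gpd.comp g h hc) m l q = theta c g m n q * theta c h n l q := by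
  have e : Gpd.snd g = Gpd.fst h := hc
  have e1 : Gpd.fst (Λ.gpd.comp g h hc) = Gpd.fst g := rfl
  have e2 : Gpd.snd (Λ.gpd.comp g h hc) = Gpd.snd h := rfl
  unfold theta
  rw [e1, e2, ← e, hg.shift]
  group

/-! ### The partition and the cocycle -/

section Partition

variable {P : Set (Λ.Mor × Λ.Mor)}

/-- The degree `d(μ_g)`. -/
noncomputable def IsPartition.left (hP : Λ.IsPartition P) (g : Λ.gpd.Mor) : Fin k → ℕ :=
  Λ.d (hP.exists_unique g).choose.1

/-- The degree `d(ν_g)`. -/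
noncomputable def IsPartition.right (hP : Λ.IsPartition P) (g : Λ.gpd.Mor) : Fin k → ℕ :=
  Λ.d (hP.exists_unique g).choose.2

theorem IsPartition.choose_eq (hP : Λ.IsPartition P) (g : Λ.gpd.Mor) :
    (hP.exists_unique g).choose =
      ((Gpd.fst g).initSeg (hP.left g), (Gpd.snd g).initSeg (hP.right g)) := by
  have h := (hP.exists_unique g).choose_spec.1.2
  rw [mem_Z_iff] at h
  exact Prod.ext h.1.symm h.2.1.symm

theorem IsPartition.rep (hP : Λ.IsPartition P) (g : Λ.gpd.Mor) :
    Gpd.Rep g (hP.left g) (hP.right g) :=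
  (mem_Z_iff.1 (hP.exists_unique g).choose_spec.1.2).2.2

theorem IsPartition.mem (hP : Λ.IsPartition P) (g : Λ.gpd.Mor) :
    ((Gpd.fst g).initSeg (hP.left g), (Gpd.snd g).initSeg (hP.right g)) ∈ P ∧
      g ∈ Λ.Z ((Gpd.fst g).initSeg (hP.left g)) ((Gpd.snd g).initSeg (hP.right g)) := by
  have h := (hP.exists_unique g).choose_spec.1
  rwa [hP.choose_eq] at h

theorem IsPartition.eq_of_mem (hP : Λ.IsPartition P) {g : Λ.gpd.Mor} {μ ν : Λ.Mor}
    (h : (μ, ν) ∈ P) (hg : g ∈ Λ.Z μ ν) :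
    μ = (Gpd.fst g).initSeg (hP.left g) ∧ ν = (Gpd.snd g).initSeg (hP.right g) ∧
      Λ.d μ = hP.left g ∧ Λ.d ν = hP.right g := by
  have e := (hP.exists_unique g).choose_spec.2 (μ, ν) ⟨h, hg⟩
  have e' := e.trans (hP.choose_eq g)
  refine ⟨congrArg Prod.fst e', congrArg Prod.snd e', ?_, ?_⟩
  · rw [IsPartition.left, ← e]
  · rw [IsPartition.right, ← e]

/-! ### Weights, adapted degrees and independence of choices -/

/-- The value `c(μ_g, α) conj(c(ν_g, α))` where `g = (μ_g α y, _, ν_g α y)` with `d(α) = a`. -/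
noncomputable def IsPartition.weight (hP : Λ.IsPartition P) (c : Λ.Pairs → Circle)
    (g : Λ.gpd.Mor) (a : Fin k → ℕ) : Circle :=
  theta c g (hP.left g) (hP.right g) a

/-- The degrees of paths `α, β, γ` adapted to the composable pair `(g, h)`. -/
structure IsPartition.Adapted (hP : Λ.IsPartition P) (g h : Λ.gpd.Mor)
    (hc : Λ.gpd.s g = Λ.gpd.r h) (a b e : Fin k → ℕ) : Prop where
  middle : hP.right g + a = hP.left h + b
  left : hP.left g + a = hP.left (Λ.gpd.comp g h hc) + e
  right : hP.right h + b = hP.right (Λ.gpd.comp g h hc) + e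

theorem IsPartition.left_sub_right (hP : Λ.IsPartition P) (g : Λ.gpd.Mor) (i : Fin k) :
    Gpd.deg g i = (hP.left g i : ℤ) - hP.right g i := by
  rw [(hP.rep g).deg, zdiff]

/-- Additivity of the middle entry under composition, rearranged so that no subtraction in ℕ occurs.
-/
theorem IsPartition.comp_degree (hP : Λ.IsPartition P) {g h : Λ.gpd.Mor}
    (hc : Λ.gpd.s g = Λ.gpd.r h) (i : Fin k) :
    hP.left (Λ.gpd.comp g h hc) i + hP.right g i + hP.right h i =
      hP.right (Λ.gpd.comp g h hc) i + hP.left g i + hP.left h i := by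
  have h1 := hP.left_sub_right g i
  have h2 := hP.left_sub_right h i
  have h3 := hP.left_sub_right (Λ.gpd.comp g h hc) i
  have h4 : Gpd.deg (Λ.gpd.comp g h hc) i = Gpd.deg g i + Gpd.deg h i := rfl
  omega

/-- The witnesses extend μ_g and μ_{gh} to the common degree d(μ_g) + d(μ_h) + d(μ_{gh}) + q; the
requirement on the right entries is then additivity of the middle entry. -/
theorem IsPartition.adapted (hP : Λ.IsPartition P) {g h : Λ.gpd.Mor}
    (hc : Λ.gpd.s g = Λ.gpd.r h) (q : Fin k → ℕ) :
    hP.Adapted g h hc (hP.left h + hP.left (Λ.gpd.comp g h hc) + q)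
      (hP.right g + hP.left (Λ.gpd.comp g h hc) + q) (hP.left g + hP.left h + q) := by
  constructor
  · abel
  · abel
  · funext i
    have := hP.comp_degree hc i
    simp only [Pi.add_apply]
    omega

theorem IsPartition.Adapted.weight_eq {hP : Λ.IsPartition P} {c : Λ.Pairs → Circle}
    (hcc : Λ.IsCocycle c) {g h : Λ.gpd.Mor}
    {hc : Λ.gpd.s g = Λ.gpd.r h} {a b e a' b' e' : Fin k → ℕ} (H : hP.Adapted g h hc a b e)
    (H' : hP.Adapted g h hc a' b' e') :
    hP.weight c g a * hP.weight c h b * (hP.weight c (Λ.gpd.comp g h hc) e)⁻¹ =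
      hP.weight c g a' * hP.weight c h b' * (hP.weight c (Λ.gpd.comp g h hc) e')⁻¹ := by
  -- Enlarging by `q` contributes one extra `theta` for each of `g`, `h` and `gh`, at degrees where
  -- the middle ones match, so these cancel by `theta_comp`.
  have stable : ∀ {a b e : Fin k → ℕ} (_ : hP.Adapted g h hc a b e) (q : Fin k → ℕ),
      hP.weight c g (a + q) * hP.weight c h (b + q) *
        (hP.weight c (Λ.gpd.comp g h hc) (e + q))⁻¹ =
      hP.weight c g a * hP.weight c h b * (hP.weight c (Λ.gpd.comp g h hc) e)⁻¹ := by
    intro a b e H q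
    have e1 := theta_comp c (l := hP.right h + b) ((hP.rep g).add a) hc q
    rw [H.middle] at e1
    unfold IsPartition.weight
    rw [theta_add hcc (hP.rep g), theta_add hcc (hP.rep h), theta_add hcc (hP.rep _), ← H.left,
      ← H.right, H.middle, e1]
    apply_fun Additive.ofMul using Additive.ofMul.injective
    simp only [ofMul_mul, ofMul_inv]
    abel
  -- The differences of `a`, `b`, `e` are determined by `g` and `h`, so the two triples are
  -- translates of each other; adding `a'` to the first and `a` to the second makes them equal.
  have hb : b + a' = b' + a := by
    funext i
    have h1 := congrFun H.middle i
    have h2 := congrFun H'.middle i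
    simp only [Pi.add_apply] at *
    omega
  have he : e + a' = e' + a := by
    funext i
    have h1 := congrFun H.left i
    have h2 := congrFun H'.left i
    simp only [Pi.add_apply] at *
    omega
  rw [← stable H a', ← stable H' a, hb, he, add_comm a a']

theorem factors_initSeg (g : Λ.gpd.Mor) {m n : Fin k → ℕ} (hg : Gpd.Rep g m n)
    {α : Λ.Mor} {y : Λ.InfPath} {a : Fin k → ℕ} (hα : α = ((Gpd.fst g).shift m).initSeg a)
    (hy : y = (Gpd.fst g).shift (m + a)) :
    Λ.Factors g ((Gpd.fst g).initSeg m) ((Gpd.snd g).initSeg n) α y := by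
  subst hα hy
  have h1 := (Gpd.fst g).s_eq_r_initSeg m a
  have h2 := (Gpd.snd g).s_eq_r_initSeg n a
  rw [← hg.shift] at h2
  have e2 := (Gpd.snd g).initSeg_comp n a
  have hr := (hg.add a).shift
  refine ⟨h1, h2, ?_, ?_, ?_⟩
  · rw [InfPath.s_initSeg, InfPath.shift_shift]
  · rw [InfPath.eq_concat_iff, Λ.d_comp, InfPath.d_initSeg, InfPath.d_initSeg,
      InfPath.initSeg_comp]
    exact ⟨rfl, rfl⟩
  · rw [InfPath.eq_concat_iff, Λ.d_comp, InfPath.d_initSeg, InfPath.d_initSeg]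
    refine ⟨?_, hr.symm⟩
    rw [← e2]
    congr 1
    rw [hg.shift]

theorem Factors.alpha_eq {g : Λ.gpd.Mor} {μ ν α : Λ.Mor} {y : Λ.InfPath}
    (h : Λ.Factors g μ ν α y) : α = ((Gpd.fst g).shift (Λ.d μ)).initSeg (Λ.d α) := by
  obtain ⟨h1, -, h3, h4, -⟩ := h
  rw [InfPath.eq_concat_iff, Λ.d_comp] at h4
  exact (InfPath.shift_comp_initSeg _ h4.1).2.symm

theorem IsPartition.nonempty_alignment (hP : Λ.IsPartition P) (gh : Λ.gpd.Pairs) :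
    Nonempty (Λ.Alignment P gh) := by
  obtain ⟨⟨g, h⟩, hc⟩ := gh
  obtain ⟨hm, hl, hr⟩ := hP.adapted hc 0
  generalize hP.left h + hP.left (Λ.gpd.comp g h hc) + 0 = a at *
  generalize hP.right g + hP.left (Λ.gpd.comp g h hc) + 0 = b at *
  generalize hP.left g + hP.left h + 0 = e at *
  have hgr := hP.rep g
  have hhr := hP.rep h
  have hghr := hP.rep (Λ.gpd.comp g h hc)
  have hsr : Gpd.snd g = Gpd.fst h := hc
  have f1 := (Gpd.fst g).s_eq_r_initSeg (hP.left g) a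
  have f2 := (Gpd.snd g).s_eq_r_initSeg (hP.right g) a
  have f3 := (Gpd.fst h).s_eq_r_initSeg (hP.left h) b
  have f4 := (Gpd.snd h).s_eq_r_initSeg (hP.right h) b
  have f5 := (Gpd.fst g).s_eq_r_initSeg (hP.left (Λ.gpd.comp g h hc)) e
  have f6 := (Gpd.snd h).s_eq_r_initSeg (hP.right (Λ.gpd.comp g h hc)) e
  have i1 := (Gpd.fst g).initSeg_comp (hP.left g) a
  have i2 := (Gpd.snd g).initSeg_comp (hP.right g) a
  have i3 := (Gpd.fst h).initSeg_comp (hP.left h) b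
  have i4 := (Gpd.snd h).initSeg_comp (hP.right h) b
  have i5 := (Gpd.fst g).initSeg_comp (hP.left (Λ.gpd.comp g h hc)) e
  have i6 := (Gpd.snd h).initSeg_comp (hP.right (Λ.gpd.comp g h hc)) e
  have hγ : ((Gpd.snd h).shift (hP.right (Λ.gpd.comp g h hc))) =
    (Gpd.fst g).shift (hP.left (Λ.gpd.comp g h hc)) := hghr.shift.symm
  -- The two entries of each element share a tail, so one segment of it extends both members of the
  -- pair in `P`.
  simp only [← hgr.shift] at f2 i2
  simp only [← hhr.shift] at f4 i4
  simp only [hγ] at f6 i6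
  refine ⟨{
    μg := (Gpd.fst g).initSeg (hP.left g)
    νg := (Gpd.snd g).initSeg (hP.right g)
    μh := (Gpd.fst h).initSeg (hP.left h)
    νh := (Gpd.snd h).initSeg (hP.right h)
    μgh := (Gpd.fst g).initSeg (hP.left (Λ.gpd.comp g h hc))
    νgh := (Gpd.snd h).initSeg (hP.right (Λ.gpd.comp g h hc))
    mem_g := hP.mem g
    mem_h := hP.mem h
    mem_gh := hP.mem (Λ.gpd.comp g h hc)
    α := ((Gpd.fst g).shift (hP.left g)).initSeg a
    β := ((Gpd.fst h).shift (hP.left h)).initSeg b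
    γ := ((Gpd.fst g).shift (hP.left (Λ.gpd.comp g h hc))).initSeg e
    y := (Gpd.fst g).shift (hP.left g + a)
    μg_α := f1
    νg_α := f2
    μh_β := f3
    νh_β := f4
    μgh_γ := f5
    νgh_γ := f6
    eq_gh := by rw [i2, i3, hm, hsr]
    eq_left := by rw [i1, i5, hl]
    eq_right := by rw [i4, i6, hr]
    factors_g := factors_initSeg g hgr rfl rfl
    factors_h := factors_initSeg h hhr rfl (by
      rw [(hgr.add a).shift, hm, hsr])
    factors_gh := factors_initSeg _ hghr rfl (by rw [hl]; rfl) }⟩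

theorem IsPartition.adapted_of_alignment (hP : Λ.IsPartition P) {g h : Λ.gpd.Mor}
    {hc : Λ.gpd.s g = Λ.gpd.r h} (A : Λ.Alignment P (Λ.gpd.pair g h hc)) :
    hP.Adapted g h hc (Λ.d A.α) (Λ.d A.β) (Λ.d A.γ) := by
  obtain ⟨-, -, hg1, hg2⟩ := hP.eq_of_mem A.mem_g.1 A.mem_g.2
  obtain ⟨-, -, hh1, hh2⟩ := hP.eq_of_mem A.mem_h.1 A.mem_h.2
  obtain ⟨-, -, hgh1, hgh2⟩ := hP.eq_of_mem A.mem_gh.1 A.mem_gh.2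
  have e1 := congrArg Λ.d A.eq_gh
  have e2 := congrArg Λ.d A.eq_left
  have e3 := congrArg Λ.d A.eq_right
  simp only [Λ.d_comp] at e1 e2 e3
  constructor
  · rw [← hg2, ← hh1, e1]
  · rw [← hg1, ← hgh1, e2]
  · rw [← hh2, ← hgh2, e3]

theorem IsPartition.weight_of_factors (hP : Λ.IsPartition P) (c : Λ.Pairs → Circle)
    {g : Λ.gpd.Mor} {μ ν α : Λ.Mor} {y : Λ.InfPath} (hm : (μ, ν) ∈ P ∧ g ∈ Λ.Z μ ν)
    (hf : Λ.Factors g μ ν α y) :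
    Λ.val c μ α * (Λ.val c ν α)⁻¹ = hP.weight c g (Λ.d α) := by
  obtain ⟨h1, h2, h3, h4⟩ := hP.eq_of_mem hm.1 hm.2
  have e := hf.alpha_eq
  unfold IsPartition.weight theta
  rw [← h1, ← h2, ← h3, ← e]

theorem IsPartition.value_eq (hP : Λ.IsPartition P) {c : Λ.Pairs → Circle}
    (hcc : Λ.IsCocycle c) {g h : Λ.gpd.Mor} {hc : Λ.gpd.s g = Λ.gpd.r h}
    (A : Λ.Alignment P (Λ.gpd.pair g h hc)) {a b e : Fin k → ℕ} (H : hP.Adapted g h hc a b e) :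
    A.value c =
      hP.weight c g a * hP.weight c h b * (hP.weight c (Λ.gpd.comp g h hc) e)⁻¹ := by
  rw [H.weight_eq hcc (hP.adapted_of_alignment A), ← hP.weight_of_factors c A.mem_g A.factors_g,
    ← hP.weight_of_factors c A.mem_h A.factors_h, ← hP.weight_of_factors c A.mem_gh A.factors_gh,
    Alignment.value, SmallCat.val_eq c A.μg_α, SmallCat.val_eq c A.νg_α, SmallCat.val_eq c A.μh_β,
    SmallCat.val_eq c A.νh_β, SmallCat.val_eq c A.μgh_γ, SmallCat.val_eq c A.νgh_γ]
  apply_fun Additive.ofMul using Additive.ofMul.injective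
  simp only [ofMul_mul, ofMul_inv]
  abel

theorem IsPartition.sigmaC_eq_value (hP : Λ.IsPartition P) {c : Λ.Pairs → Circle}
    (hcc : Λ.IsCocycle c) {gh : Λ.gpd.Pairs} (A : Λ.Alignment P gh) :
    Λ.sigmaC P c gh = A.value c := by
  obtain ⟨⟨g, h⟩, hc⟩ := gh
  rw [sigmaC, dif_pos ⟨A⟩, hP.value_eq hcc A (hP.adapted hc 0),
    hP.value_eq hcc _ (hP.adapted hc 0)]

/-- Trades a choice of paths for a choice of degrees: any adapted triple computes σ_c, so later
arguments pick convenient ones. -/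
theorem IsPartition.sigmaC_eq (hP : Λ.IsPartition P) {c : Λ.Pairs → Circle}
    (hcc : Λ.IsCocycle c) {g h : Λ.gpd.Mor} {hc : Λ.gpd.s g = Λ.gpd.r h} {a b e : Fin k → ℕ}
    (H : hP.Adapted g h hc a b e) :
    Λ.sigmaC P c (Λ.gpd.pair g h hc) =
      hP.weight c g a * hP.weight c h b * (hP.weight c (Λ.gpd.comp g h hc) e)⁻¹ := by
  obtain ⟨A⟩ := hP.nonempty_alignment (Λ.gpd.pair g h hc)
  rw [hP.sigmaC_eq_value hcc A, hP.value_eq hcc A H]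

/-- The condition (λ, s(λ)) ∈ P enters here, for λ a vertex: the unit at x lies in Z(r(x), r(x)).
This is what normalises σ_c. -/
theorem IsPartition.degree_one (hP : Λ.IsPartition P) (x : Λ.InfPath) :
    hP.left (Λ.gpd.one x) = 0 ∧ hP.right (Λ.gpd.one x) = 0 := by
  have h0 : x.initSeg 0 = Λ.one x.range := by
    rw [eq_one_of_d_eq_zero (x.d_initSeg 0), x.r_initSeg]
  have hm : Λ.gpd.one x ∈ Λ.Z (Λ.one x.range) (Λ.one x.range) := by
    rw [mem_Z_iff, Λ.d_one]
    refine ⟨h0, h0, ?_, rfl⟩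
    funext i
    simp [gpd, Gpd.deg, zdiff]
  have hb := hP.base_mem (Λ.one x.range)
  rw [Λ.s_one] at hb
  obtain ⟨-, -, h1, h2⟩ := hP.eq_of_mem hb hm
  rw [Λ.d_one] at h1 h2
  exact ⟨h1.symm, h2.symm⟩

theorem IsPartition.weight_one (hP : Λ.IsPartition P) (c : Λ.Pairs → Circle) (x : Λ.InfPath)
    (a : Fin k → ℕ) : hP.weight c (Λ.gpd.one x) a = 1 := by
  rw [weight, (hP.degree_one x).1, (hP.degree_one x).2]
  exact mul_inv_cancel _

theorem IsPartition.isCocycle_sigmaC (hP : Λ.IsPartition P) {c : Λ.Pairs → Circle}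
    (hcc : Λ.IsCocycle c) : Λ.gpd.IsCocycle (Λ.sigmaC P c) where
  right_one g := by
    have H : hP.Adapted g (Λ.gpd.one (Λ.gpd.s g)) (Λ.gpd.r_one _).symm 0 (hP.right g) 0 := by
      constructor
      · rw [(hP.degree_one (Λ.gpd.s g)).1, add_comm]
      · rw [Λ.gpd.comp_one]
      · rw [Λ.gpd.comp_one, (hP.degree_one (Λ.gpd.s g)).2, add_comm]
    rw [hP.sigmaC_eq hcc H, hP.weight_one c (Λ.gpd.s g), Λ.gpd.comp_one, mul_one, mul_inv_cancel]
  left_one g := by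
    have H : hP.Adapted (Λ.gpd.one (Λ.gpd.r g)) g (Λ.gpd.s_one _) (hP.left g) 0 0 := by
      constructor
      · rw [(hP.degree_one (Λ.gpd.r g)).2, add_comm]
      · rw [Λ.gpd.one_comp, (hP.degree_one (Λ.gpd.r g)).1, add_comm]
      · rw [Λ.gpd.one_comp]
    rw [hP.sigmaC_eq hcc H, hP.weight_one c (Λ.gpd.r g), Λ.gpd.one_comp, one_mul, mul_inv_cancel]
  cocycle f g h hfg hgh := by
    have hf' := hfg.trans (Λ.gpd.r_comp g h hgh).symm
    have hh' := (Λ.gpd.s_comp f g hfg).trans hgh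
    have E := Λ.gpd.assoc f g h hfg hgh
    -- `L`, `e₁`, `e` extend μ_f, μ_{fg}, μ_{fgh} to one common degree; `b`, `a'`, `e₂` are then
    -- forced for `g`, `h`, `gh`. With one degree per element, both sides reduce to the weights of
    -- `f`, `g`, `h` over that of `fgh`.
    let L := hP.left (Λ.gpd.comp f g hfg) + hP.left (Λ.gpd.comp g h hgh) +
      hP.left (Λ.gpd.comp f (Λ.gpd.comp g h hgh) hf') + hP.left g + hP.left h
    have d1 := fun i => hP.comp_degree hfg i
    have d2 := fun i => hP.comp_degree hgh i
    have d3 := fun i => hP.comp_degree hf' i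
    let b := hP.right f + hP.left (Λ.gpd.comp f g hfg) + hP.left (Λ.gpd.comp g h hgh) +
      hP.left (Λ.gpd.comp f (Λ.gpd.comp g h hgh) hf') + hP.left h
    let a' := hP.right g + hP.right f + hP.left (Λ.gpd.comp f g hfg) +
      hP.left (Λ.gpd.comp g h hgh) + hP.left (Λ.gpd.comp f (Λ.gpd.comp g h hgh) hf')
    let e₁ := hP.left f + hP.left (Λ.gpd.comp g h hgh) +
      hP.left (Λ.gpd.comp f (Λ.gpd.comp g h hgh) hf') + hP.left g + hP.left h
    let e₂ := hP.right f + hP.left (Λ.gpd.comp f g hfg) +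
      hP.left (Λ.gpd.comp f (Λ.gpd.comp g h hgh) hf') + hP.left g + hP.left h
    let e := hP.left f + hP.left (Λ.gpd.comp f g hfg) + hP.left (Λ.gpd.comp g h hgh) +
      hP.left g + hP.left h
    have H1 : hP.Adapted g h hgh b a' e₂ := by
      constructor <;> funext i <;> have := d2 i <;> simp only [b, a', e₂, Pi.add_apply] <;> omega
    have H2 : hP.Adapted f (Λ.gpd.comp g h hgh) hf' L e₂ e := by
      constructor <;> funext i <;> have := d3 i <;> simp only [L, e, e₂, Pi.add_apply] <;> omega
    have H3 : hP.Adapted f g hfg L b e₁ := by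
      constructor <;> funext i <;> have := d1 i <;> simp only [L, b, e₁, Pi.add_apply] <;> omega
    have H4 : hP.Adapted (Λ.gpd.comp f g hfg) h hh' e₁ a' e := by
      constructor <;> (try rw [E]) <;> funext i <;> have := d1 i <;> have := d2 i <;>
        have := d3 i <;> simp only [a', e, e₁, Pi.add_apply] <;> omega
    rw [hP.sigmaC_eq hcc H1, hP.sigmaC_eq hcc H2, hP.sigmaC_eq hcc H3, hP.sigmaC_eq hcc H4, E]
    apply_fun Additive.ofMul using Additive.ofMul.injective
    simp only [ofMul_mul, ofMul_inv]
    abel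

end Partition

end KGraph

namespace KGraph

variable {k : ℕ} {Λ : KGraph.{u} k}

theorem InfPath.ext_forall_initSeg {x y : Λ.InfPath} (h : ∀ n, x.initSeg n = y.initSeg n) :
    x = y := by
  have key : ∀ (z : Λ.InfPath) (m q : Fin k → ℕ),
      z.seg m (m + q) le_self_add = (z.shift m).initSeg q := by
    intro z m q
    simp only [initSeg, shift]
    congr 1
    · exact (zero_add m).symm
    · exact add_comm m q
  apply InfPath.ext_seg
  intro m n hmn
  obtain ⟨q, rfl⟩ := exists_add_of_le hmn
  rw [key, key]
  exact (initSeg_add_inj (h (m + q))).2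

/-! ### Neighbourhoods in the path groupoid -/

/-- The basic open set `Z(x(0,m), y(0,n))`, for `g = (x, m - n, y)`. -/
def cyl (g : Λ.gpd.Mor) (m n : Fin k → ℕ) : Set Λ.gpd.Mor :=
  Λ.Z ((Gpd.fst g).initSeg m) ((Gpd.snd g).initSeg n)

theorem mem_cyl {g g' : Λ.gpd.Mor} {m n : Fin k → ℕ} :
    g' ∈ cyl g m n ↔ (Gpd.fst g').initSeg m = (Gpd.fst g).initSeg m ∧
      (Gpd.snd g').initSeg n = (Gpd.snd g).initSeg n ∧ Gpd.Rep g' m n := by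
  rw [cyl, mem_Z_iff, InfPath.d_initSeg, InfPath.d_initSeg]

theorem self_mem_cyl {g : Λ.gpd.Mor} {m n : Fin k → ℕ} (h : Gpd.Rep g m n) : g ∈ cyl g m n :=
  mem_cyl.2 ⟨rfl, rfl, h⟩

theorem isOpen_cyl {g : Λ.gpd.Mor} {m n : Fin k → ℕ} (h : Gpd.Rep g m n) :
    IsOpen (cyl g m n) := by
  apply TopologicalSpace.isOpen_generateFrom_of_mem
  refine ⟨_, _, ?_, rfl⟩
  rw [InfPath.s_initSeg, InfPath.s_initSeg, h.shift]

theorem cyl_anti {g : Λ.gpd.Mor} {m n : Fin k → ℕ} (h : Gpd.Rep g m n) (q : Fin k → ℕ) :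
    cyl g (m + q) (n + q) ⊆ cyl g m n := by
  intro g' hg'
  rw [mem_cyl] at hg' ⊢
  obtain ⟨h1, h2, h3⟩ := hg'
  have e1 := InfPath.initSeg_add_inj h1
  have e2 := InfPath.initSeg_add_inj h2
  refine ⟨e1.1, e2.1, ?_, InfPath.ext_initSeg (n := q) ?_ ?_⟩
  · rw [h3.deg]
    funext i
    simp [zdiff]
  · rw [e1.2, e2.2, h.shift]
  · rw [InfPath.shift_shift, InfPath.shift_shift, h3.shift]

/-- Two representations of the same degree agree after translation. Asking for all enlargements `q`
is what carries the induction through intersections. -/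
theorem exists_cyl_subset {g : Λ.gpd.Mor} {U : Set Λ.gpd.Mor} (hU : IsOpen U) (hg : g ∈ U) :
    ∃ m n, Gpd.Rep g m n ∧ ∀ q, cyl g (m + q) (n + q) ⊆ U := by
  induction hU with
  | basic s hs =>
    obtain ⟨μ, ν, -, rfl⟩ := hs
    have hg' := mem_Z_iff.1 hg
    refine ⟨Λ.d μ, Λ.d ν, hg'.2.2, fun q => (cyl_anti hg'.2.2 q).trans ?_⟩
    rw [cyl, hg'.1, hg'.2.1]
  | univ =>
    obtain ⟨m, n, h⟩ := Gpd.exists_rep g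
    exact ⟨m, n, h, fun _ => Set.subset_univ _⟩
  | inter s t _ _ ihs iht =>
    obtain ⟨m, n, h, hs⟩ := ihs hg.1
    obtain ⟨m', n', h', ht⟩ := iht hg.2
    refine ⟨m + m', n + m', h.add m', fun q => Set.subset_inter ?_ ?_⟩
    · rw [add_assoc, add_assoc]
      exact hs _
    · have hn : n + m' = n' + m := by
        funext i
        have e := congrFun (h.deg.symm.trans h'.deg) i
        simp only [zdiff] at e
        simp only [Pi.add_apply]
        omega
      rw [hn, add_comm m, add_assoc, add_assoc]
      exact ht _
  | sUnion S _ ih =>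
    obtain ⟨s, hs, hgs⟩ := hg
    obtain ⟨m, n, h, hc⟩ := ih s hs hgs
    exact ⟨m, n, h, fun q => (hc q).trans (Set.subset_sUnion_of_mem hs)⟩

theorem comp_mem_cyl {g h g' h' : Λ.gpd.Mor} {m n l : Fin k → ℕ} (hc : Λ.gpd.s g = Λ.gpd.r h)
    (hc' : Λ.gpd.s g' = Λ.gpd.r h') (hg : g' ∈ cyl g m n) (hh : h' ∈ cyl h n l) :
    Λ.gpd.comp g' h' hc' ∈ cyl (Λ.gpd.comp g h hc) m l := by
  rw [mem_cyl] at *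
  exact ⟨hg.1, hh.2.1, hg.2.2.comp hh.2.2 hc'⟩

theorem continuous_of_locally_eq {X Y : Type*} [TopologicalSpace X] [TopologicalSpace Y]
    {f : X → Y} (h : ∀ x, ∃ U, IsOpen U ∧ x ∈ U ∧ ∀ y ∈ U, f y = f x) : Continuous f :=
  ((IsLocallyConstant.iff_exists_open f).2 h).continuous

theorem continuous_comp :
    Continuous fun p : Λ.gpd.Pairs => Λ.gpd.comp p.1.1 p.1.2 p.2 := by
  rw [continuous_generateFrom_iff]
  rintro U ⟨μ, ν, hs, rfl⟩
  rw [isOpen_iff_forall_mem_open]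
  rintro ⟨⟨g, h⟩, hc⟩ hgh
  obtain ⟨m, n, hg⟩ := Gpd.exists_rep g
  obtain ⟨n', l, hh⟩ := Gpd.exists_rep h
  have hgh' := mem_Z_iff.1 hgh
  have hg2 := hg.add (n' + Λ.d μ)
  have hh2 := hh.add (n + Λ.d μ)
  have hn : n' + (n + Λ.d μ) = n + (n' + Λ.d μ) := by abel
  rw [hn] at hh2
  refine ⟨{p | p.1.1 ∈ cyl g (m + (n' + Λ.d μ)) (n + (n' + Λ.d μ)) ∧
    p.1.2 ∈ cyl h (n + (n' + Λ.d μ)) (l + (n + Λ.d μ))}, ?_,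
    ((isOpen_cyl hg2).preimage (continuous_fst.comp continuous_subtype_val)).inter
      ((isOpen_cyl hh2).preimage (continuous_snd.comp continuous_subtype_val)),
    self_mem_cyl hg2, self_mem_cyl hh2⟩
  rintro ⟨⟨g', h'⟩, hc'⟩ ⟨h1, h2⟩
  have h3 := comp_mem_cyl hc hc' h1 h2
  -- The extra `Λ.d μ` in the chosen degrees ensures that the product cylinder is a refinement of `Z
  -- μ ν`; the second degree then follows by comparing middle entries.
  have e1 : m + (n' + Λ.d μ) = Λ.d μ + (m + n') := by abel
  have e2 : l + (n + Λ.d μ) = Λ.d ν + (m + n') := by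
    have d1 := hgh'.2.2.deg
    have d2 := (hg2.comp hh2 hc).deg
    funext i
    have d3 := congrFun (d1.symm.trans d2) i
    simp only [zdiff, Pi.add_apply] at *
    push_cast at d3
    omega
  rw [e1, e2] at h3
  have h4 := cyl_anti hgh'.2.2 _ h3
  rwa [cyl, hgh'.1, hgh'.2.1] at h4

/-! ### Continuity of σ_c -/

section Partition

variable {P : Set (Λ.Mor × Λ.Mor)}

/-- The cylinder lies inside the piece of the partition containing `g`, and the weight reads only
the segments that the cylinder fixes. -/
theorem IsPartition.eq_of_mem_cyl (hP : Λ.IsPartition P) {g g' : Λ.gpd.Mor} {a : Fin k → ℕ}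
    (h : g' ∈ cyl g (hP.left g + a) (hP.right g + a)) :
    hP.left g' = hP.left g ∧ hP.right g' = hP.right g ∧
      ∀ c, hP.weight c g' a = hP.weight c g a := by
  have h' := cyl_anti (hP.rep g) a h
  obtain ⟨-, -, h1, h2⟩ := hP.eq_of_mem (hP.mem g).1 h'
  rw [InfPath.d_initSeg] at h1 h2
  refine ⟨h1.symm, h2.symm, fun c => ?_⟩
  obtain ⟨e1, e2, -⟩ := mem_cyl.1 h
  unfold weight theta
  rw [← h1, ← h2, (InfPath.initSeg_add_inj e1).1,
    (InfPath.initSeg_add_inj e2).1, (InfPath.initSeg_add_inj e1).2]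

theorem IsPartition.sigmaC_eq_of_mem_cyl (hP : Λ.IsPartition P) {c : Λ.Pairs → Circle}
    (hcc : Λ.IsCocycle c) {g h : Λ.gpd.Mor} (hc : Λ.gpd.s g = Λ.gpd.r h) :
    ∃ m n l, Gpd.Rep g m n ∧ Gpd.Rep h n l ∧ ∀ g' ∈ cyl g m n, ∀ h' ∈ cyl h n l,
      ∀ hc' : Λ.gpd.s g' = Λ.gpd.r h',
        Λ.sigmaC P c (Λ.gpd.pair g' h' hc') = Λ.sigmaC P c (Λ.gpd.pair g h hc) := by
  have H := hP.adapted hc 0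
  generalize hP.left h + hP.left (Λ.gpd.comp g h hc) + 0 = a at *
  generalize hP.right g + hP.left (Λ.gpd.comp g h hc) + 0 = b at *
  generalize hP.left g + hP.left h + 0 = e at *
  refine ⟨hP.left g + a, hP.right g + a, hP.right h + b, (hP.rep g).add a, ?_, ?_⟩
  · rw [H.middle]
    exact (hP.rep h).add b
  intro g' h1 h' h2 hc'
  have h3 := comp_mem_cyl hc hc' h1 h2
  rw [H.middle] at h2
  rw [H.left, H.right] at h3
  obtain ⟨l1, r1, w1⟩ := hP.eq_of_mem_cyl h1
  obtain ⟨l2, r2, w2⟩ := hP.eq_of_mem_cyl h2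
  obtain ⟨l3, r3, w3⟩ := hP.eq_of_mem_cyl h3
  have H' : hP.Adapted g' h' hc' a b e := by
    constructor
    · rw [r1, l2, H.middle]
    · rw [l1, l3, H.left]
    · rw [r2, r3, H.right]
  rw [hP.sigmaC_eq hcc H, hP.sigmaC_eq hcc H', w1, w2, w3]

theorem IsPartition.continuous_sigmaC (hP : Λ.IsPartition P) {c : Λ.Pairs → Circle}
    (hcc : Λ.IsCocycle c) : Continuous (Λ.sigmaC P c) := by
  apply continuous_of_locally_eq
  rintro ⟨⟨g, h⟩, hc⟩
  obtain ⟨m, n, l, hg, hh, H⟩ := hP.sigmaC_eq_of_mem_cyl hcc hc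
  refine ⟨{p | p.1.1 ∈ cyl g m n ∧ p.1.2 ∈ cyl h n l},
    ((isOpen_cyl hg).preimage (continuous_fst.comp continuous_subtype_val)).inter
      ((isOpen_cyl hh).preimage (continuous_snd.comp continuous_subtype_val)),
    ⟨self_mem_cyl hg, self_mem_cyl hh⟩, ?_⟩
  rintro ⟨⟨g', h'⟩, hc'⟩ ⟨h1, h2⟩
  exact H g' h1 h' h2 hc'

end Partition

/-! ### The interior of the isotropy -/

/-- If `p ∈ Per(Λ)` and `p = m - n` with `T^m x = T^n x`, then `T^m z = T^n z` for all `z` close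
to `x`. -/
theorem exists_isoElt_mem_cyl (hrow : Λ.RowFiniteNoSources) (hcof : Λ.IsCofinal)
    {x : Λ.InfPath} {p : Λ.per} {m n : Fin k → ℕ} (h : Gpd.Rep (isoElt hcof x p) m n) :
    ∃ N, ∀ z : Λ.InfPath, z.initSeg N = x.initSeg N →
      isoElt hcof z p ∈ cyl (isoElt hcof x p) m n := by
  have hp : (p : Fin k → ℤ) ∈ Λ.perSet := by
    rw [← coe_per hrow hcof x]
    exact p.2
  obtain ⟨μ, ν, hE, hpd⟩ := hp
  -- Cofinality carries the coincidence of T^{d(μ)} and T^{d(ν)} from paths starting at s(μ) to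
  -- paths starting at x(q), in particular to T^q z for z close to x.
  obtain ⟨q, l, hl, hq⟩ := hcof x (Λ.s μ)
  have hmn : m + (q + Λ.d ν) = n + (q + Λ.d μ) := by
    funext i
    have e := congrFun (hpd.symm.trans h.deg) i
    simp only [zdiff] at e
    simp only [Pi.add_apply]
    omega
  have hx : x.shift m = x.shift n := h.shift
  refine ⟨m + n + (q + Λ.d μ), fun z hz => ?_⟩
  have hz1 : z.initSeg (m + (q + Λ.d μ)) = x.initSeg (m + (q + Λ.d μ)) :=
    InfPath.initSeg_mono (fun i => by simp only [Pi.add_apply]; omega) hz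
  have hz2 : z.initSeg (n + (q + Λ.d μ)) = x.initSeg (n + (q + Λ.d μ)) :=
    InfPath.initSeg_mono (fun i => by simp only [Pi.add_apply]; omega) hz
  have hzq : z.initSeg q = x.initSeg q :=
    InfPath.initSeg_mono (fun i => by simp only [Pi.add_apply]; omega) hz
  have e := shift_eq_of_path hE.shift_eq l hl (z.shift q)
    (by rw [← InfPath.s_initSeg, hzq, InfPath.s_initSeg, InfPath.range_shift, hq])
  rw [InfPath.shift_shift, InfPath.shift_shift] at e
  refine mem_cyl.2 ⟨(InfPath.initSeg_add_inj hz1).1, (InfPath.initSeg_add_inj hz2).1, h.deg, ?_⟩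
  change z.shift m = z.shift n
  -- Up to degree q + d(μ) the two shifts of z agree because z follows x; beyond it they agree by
  -- periodicity of T^q z.
  refine InfPath.ext_initSeg (n := q + Λ.d μ) ?_ ?_
  · rw [(InfPath.initSeg_add_inj hz1).2, (InfPath.initSeg_add_inj hz2).2, hx]
  · rw [InfPath.shift_comm, e, InfPath.shift_comm, InfPath.shift_shift, InfPath.shift_shift, hmn]

/-- In a basic open set the first entry determines the last. For g near (x, p, x) with first entry
z, both g and (z, p, z) lie in one such set, so the last entry of g is also z. -/
theorem isoElt_mem_isotropyInterior (hrow : Λ.RowFiniteNoSources) (hcof : Λ.IsCofinal)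
    (x : Λ.InfPath) (p : Λ.per) : isoElt hcof x p ∈ Λ.isotropyInterior := by
  obtain ⟨m, n, hrep⟩ := Gpd.exists_rep (isoElt hcof x p)
  obtain ⟨N, hN⟩ := exists_isoElt_mem_cyl hrow hcof hrep
  refine mem_interior.2 ⟨_, fun g hg => ?_, isOpen_cyl (hrep.add N), self_mem_cyl (hrep.add N)⟩
  obtain ⟨-, h2, h3⟩ := mem_cyl.1 (cyl_anti hrep _ hg)
  obtain ⟨-, h5, h6⟩ := mem_cyl.1 (hN (Gpd.fst g)
    (InfPath.initSeg_mono le_add_self (mem_cyl.1 hg).1))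
  exact InfPath.ext_initSeg (n := n) (h5.trans h2.symm) (h6.shift.symm.trans h3.shift)

/-- A basic neighbourhood Z(μ, ν) contained in the isotropy says exactly that μz = νz for every z,
that is, μ ∼ ν. -/
theorem eq_isoElt_of_mem_isotropyInterior (hcof : Λ.IsCofinal) {g : Λ.gpd.Mor}
    (hg : g ∈ Λ.isotropyInterior) : ∃ x p, g = isoElt hcof x p := by
  obtain ⟨m, n, hrep, hsub⟩ := exists_cyl_subset isOpen_interior hg
  have hrep' := hrep.add 0
  have hsub' := (hsub 0).trans interior_subset
  generalize m + 0 = m at *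
  generalize n + 0 = n at *
  have hiso : g ∈ Λ.isotropy := interior_subset hg
  change Gpd.fst g = Gpd.snd g at hiso
  have hs : Λ.s ((Gpd.fst g).initSeg m) = Λ.s ((Gpd.snd g).initSeg n) := by
    rw [InfPath.s_initSeg, InfPath.s_initSeg, hrep'.shift]
  have hE : Λ.Equi ((Gpd.fst g).initSeg m) ((Gpd.snd g).initSeg n) := by
    refine ⟨hs, fun z hz => ?_⟩
    have hz' := hs.symm.trans hz
    let g' : Λ.Gpd := ⟨(InfPath.concat _ z hz, zdiff m n, InfPath.concat _ z hz'), m, n, rfl, by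
      have e1 := InfPath.shift_concat _ z hz
      have e2 := InfPath.shift_concat _ z hz'
      rw [InfPath.d_initSeg] at e1 e2
      exact e1.trans e2.symm⟩
    have hg' : g' ∈ cyl g m n := by
      refine ⟨z, hz, hz', rfl, ?_, rfl⟩
      rw [InfPath.d_initSeg, InfPath.d_initSeg]
      rfl
    exact hsub' hg'
  have hmem : Gpd.deg g ∈ Λ.per := by
    apply AddSubgroup.subset_closure
    refine ⟨_, _, hE, ?_⟩
    rw [InfPath.d_initSeg, InfPath.d_initSeg, hrep'.deg]
  exact ⟨Gpd.fst g, ⟨Gpd.deg g, hmem⟩, Gpd.ext' rfl rfl hiso.symm⟩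

theorem isotropyInterior_eq (hrow : Λ.RowFiniteNoSources) (hcof : Λ.IsCofinal) :
    Λ.isotropyInterior = {g | ∃ x p, g = isoElt hcof x p} := by
  ext g
  refine ⟨eq_isoElt_of_mem_isotropyInterior hcof, ?_⟩
  rintro ⟨x, p, rfl⟩
  exact isoElt_mem_isotropyInterior hrow hcof x p

/-- Off the isotropy, two initial segments differ and this persists nearby. On it, the middle entry
is constant nearby and membership depends on it alone. Closedness makes the later extension by 1
continuous. -/
theorem isClosed_isotropyInterior (hrow : Λ.RowFiniteNoSources) (hcof : Λ.IsCofinal) :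
    IsClosed Λ.isotropyInterior := by
  rw [← isOpen_compl_iff, isOpen_iff_forall_mem_open]
  intro g hg
  obtain ⟨m, n, hrep⟩ := Gpd.exists_rep g
  by_cases hiso : Gpd.fst g = Gpd.snd g
  · refine ⟨cyl g m n, fun g' hg' hg'' => hg ?_, isOpen_cyl hrep, self_mem_cyl hrep⟩
    obtain ⟨x, p, rfl⟩ := eq_isoElt_of_mem_isotropyInterior hcof hg''
    have hd : (p : Fin k → ℤ) = Gpd.deg g := ((mem_cyl.1 hg').2.2.deg).trans hrep.deg.symm
    have e : g = isoElt hcof (Gpd.fst g) p := Gpd.ext' rfl hd.symm hiso.symm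
    rw [e]
    exact isoElt_mem_isotropyInterior hrow hcof _ p
  · obtain ⟨N, hN⟩ : ∃ N, (Gpd.fst g).initSeg N ≠ (Gpd.snd g).initSeg N := by
      by_contra! h
      exact hiso (InfPath.ext_forall_initSeg h)
    refine ⟨cyl g (m + N) (n + N), fun g' hg' hg'' => hN ?_, isOpen_cyl (hrep.add N),
      self_mem_cyl (hrep.add N)⟩
    have e : g' ∈ Λ.isotropy := interior_subset hg''
    change Gpd.fst g' = Gpd.snd g' at e
    obtain ⟨h1, h2, -⟩ := mem_cyl.1 hg'
    rw [← InfPath.initSeg_mono le_add_self h1, ← InfPath.initSeg_mono le_add_self h2, e]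

end KGraph

/-! ### Products of cocycles, coboundaries, and cocycles on groups -/

namespace SmallCat

theorem IsCocycle.mul {C : SmallCat.{u}} {c c' : C.Pairs → Circle} (h : C.IsCocycle c)
    (h' : C.IsCocycle c') : C.IsCocycle fun p => c p * c' p where
  right_one μ := by rw [h.right_one, h'.right_one, mul_one]
  left_one μ := by rw [h.left_one, h'.left_one, mul_one]
  cocycle l μ ν h1 h2 := by
    rw [mul_mul_mul_comm, h.cocycle l μ ν h1 h2, h'.cocycle l μ ν h1 h2, mul_mul_mul_comm]

theorem isCocycle_coboundary {C : SmallCat.{u}} {b : C.Mor → Circle}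
    (hb : ∀ v, b (C.one v) = 1) : C.IsCocycle (C.coboundary b) where
  right_one μ := by
    simp only [coboundary, C.comp_one, hb, mul_one, mul_inv_cancel]
  left_one μ := by
    simp only [coboundary, C.one_comp, hb, one_mul, mul_inv_cancel]
  cocycle l μ ν h h' := by
    simp only [coboundary, C.assoc l μ ν h h']
    apply_fun Additive.ofMul using Additive.ofMul.injective
    simp only [ofMul_mul, ofMul_inv]
    abel

end SmallCat

theorem isCocycle_groupCochain {A : Type u} [AddCommGroup A] {f : A → A → Circle}
    (hf : IsAddCocycle fun p q => Additive.ofMul (f p q)) :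
    (SmallCat.ofAddGroup A).IsCocycle (groupCochain f) where
  right_one p := hf.zero_right p
  left_one p := hf.zero_left p
  cocycle p q t _ _ := hf.cocycle p q t

theorem cohomologous_groupCochain_iff {A : Type u} [AddCommGroup A] {f f' : A → A → Circle} :
    (SmallCat.ofAddGroup A).Cohomologous (groupCochain f) (groupCochain f') ↔
      ∃ b : A → Circle, b 0 = 1 ∧ ∀ p q, (f p q)⁻¹ * f' p q = b p * b q * (b (p + q))⁻¹ :=
  ⟨fun ⟨b, h, h'⟩ => ⟨b, h PUnit.unit, fun p q => h' ⟨(p, q), rfl⟩⟩,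
    fun ⟨b, h, h'⟩ => ⟨b, fun _ => h, fun p => h' p.1.1 p.1.2⟩⟩

theorem IsBicharacter.isAddCocycle {A : Type u} [AddCommGroup A] {ω : A → A → Circle}
    (h : IsBicharacter ω) : IsAddCocycle fun p q => Additive.ofMul (ω p q) where
  zero_left p := by
    have := h.1 0 0 p
    rwa [add_zero, left_eq_mul] at this
  zero_right p := by
    have := h.2 p 0 0
    rwa [add_zero, left_eq_mul] at this
  cocycle p q t := by
    simp only [h.1, h.2, ofMul_mul]
    abel

namespace KGraph

variable {k : ℕ} {Λ : KGraph.{u} k}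

/-! ### The fibres of a groupoid cocycle and the common bicharacter -/

theorem isAddCocycle_fibre (hcof : Λ.IsCofinal) {σ : Λ.gpd.Pairs → Circle}
    (hσ : Λ.gpd.IsCocycle σ) (x : Λ.InfPath) :
    IsAddCocycle fun p q => Additive.ofMul (fibre hcof σ x p q) where
  zero_left p := hσ.left_one (isoElt hcof x p)
  zero_right p := hσ.right_one (isoElt hcof x p)
  cocycle p q t := hσ.cocycle (isoElt hcof x p) (isoElt hcof x q) (isoElt hcof x t) rfl rfl

/-- The element (x, m, T^m x) intertwines (x, p, x) with (T^m x, p, T^m x), and likewise for q. -/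
theorem fibre_antisymm_shift (hcof : Λ.IsCofinal) {σ : Λ.gpd.Pairs → Circle}
    (hσ : Λ.gpd.IsCocycle σ) (x : Λ.InfPath) (m : Fin k → ℕ) (p q : Λ.per) :
    fibre hcof σ x p q * (fibre hcof σ x q p)⁻¹ =
      fibre hcof σ (x.shift m) p q * (fibre hcof σ (x.shift m) q p)⁻¹ := by
  let g : Λ.gpd.Mor := ⟨(x, zdiff m 0, x.shift m), m, 0, rfl, (x.shift m).shift_zero.symm⟩
  have h := hσ.antisymm_conj (a := isoElt hcof x p) (b := isoElt hcof x q)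
    (a' := isoElt hcof (x.shift m) p) (b' := isoElt hcof (x.shift m) q) (g := g)
    rfl rfl rfl rfl rfl rfl rfl rfl (Gpd.ext' rfl (add_comm _ _) rfl)
    (Gpd.ext' rfl (add_comm _ _) rfl) (Gpd.ext' rfl (add_comm _ _) rfl)
    (Gpd.ext' rfl (add_comm _ _) rfl)
  rwa [SmallCat.val_eq σ rfl, SmallCat.val_eq σ rfl, SmallCat.val_eq σ rfl,
    SmallCat.val_eq σ rfl] at h

variable (Λ) in
/-- The group of locally constant functions on the infinite path space. -/
def locallyConstant : Subgroup (Λ.InfPath → Circle) where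
  carrier := {φ | ∀ x, ∃ N, ∀ z : Λ.InfPath, z.initSeg N = x.initSeg N → φ z = φ x}
  mul_mem' {φ ψ} hφ hψ x := by
    obtain ⟨N, hN⟩ := hφ x
    obtain ⟨M, hM⟩ := hψ x
    refine ⟨N + M, fun z hz => ?_⟩
    rw [Pi.mul_apply, Pi.mul_apply, hN z (InfPath.initSeg_mono le_self_add hz),
      hM z (InfPath.initSeg_mono le_add_self hz)]
  one_mem' x := ⟨0, fun _ _ => rfl⟩
  inv_mem' {φ} hφ x := by
    obtain ⟨N, hN⟩ := hφ x
    exact ⟨N, fun z hz => by rw [Pi.inv_apply, Pi.inv_apply, hN z hz]⟩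

section Partition

variable {P : Set (Λ.Mor × Λ.Mor)}

theorem IsPartition.fibre_mem_locallyConstant (hP : Λ.IsPartition P)
    (hrow : Λ.RowFiniteNoSources) (hcof : Λ.IsCofinal) {c : Λ.Pairs → Circle}
    (hcc : Λ.IsCocycle c) (p q : Λ.per) :
    (fun x => fibre hcof (Λ.sigmaC P c) x p q) ∈ Λ.locallyConstant := by
  intro x
  obtain ⟨m, n, l, hg, hh, H⟩ := hP.sigmaC_eq_of_mem_cyl hcc
    (g := isoElt hcof x p) (h := isoElt hcof x q) rfl
  obtain ⟨N, hN⟩ := exists_isoElt_mem_cyl hrow hcof hg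
  obtain ⟨M, hM⟩ := exists_isoElt_mem_cyl hrow hcof hh
  exact ⟨N + M, fun z hz => H _ (hN z (InfPath.initSeg_mono le_self_add hz)) _
    (hM z (InfPath.initSeg_mono le_add_self hz)) rfl⟩

/-- Cofinality gives l such that y(0,N) l T^n x is defined. This path is close to y, where the
locally constant ratio has its value at y, and shares a tail with x, so shift invariance gives the
value at x. -/
theorem IsPartition.fibre_antisymm_eq (hP : Λ.IsPartition P)
    (hrow : Λ.RowFiniteNoSources) (hcof : Λ.IsCofinal) {c : Λ.Pairs → Circle}
    (hcc : Λ.IsCocycle c) (x y : Λ.InfPath) (p q : Λ.per) :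
    fibre hcof (Λ.sigmaC P c) x p q * (fibre hcof (Λ.sigmaC P c) x q p)⁻¹ =
      fibre hcof (Λ.sigmaC P c) y p q * (fibre hcof (Λ.sigmaC P c) y q p)⁻¹ := by
  obtain ⟨N, hN⟩ := mul_mem (hP.fibre_mem_locallyConstant hrow hcof hcc p q)
    (inv_mem (hP.fibre_mem_locallyConstant hrow hcof hcc q p)) y
  obtain ⟨n, l, hl, hn⟩ := hcof x (y.vert N)
  have h1 : Λ.s l = (x.shift n).range := hn.trans (x.range_shift n).symm
  have h2 : Λ.s (y.initSeg N) = (InfPath.concat l _ h1).range := by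
    rw [InfPath.s_initSeg, InfPath.range_shift, InfPath.range_concat, hl]
  have e1 := InfPath.initSeg_concat _ _ h2
  have e2 := InfPath.shift_concat _ _ h2
  rw [InfPath.d_initSeg] at e1 e2
  have hz := hN _ e1
  have hσ := hP.isCocycle_sigmaC hcc
  refine Eq.trans ?_ hz
  have e3 := (fibre_antisymm_shift hcof hσ (InfPath.concat _ _ h2) N p q).trans
    (fibre_antisymm_shift hcof hσ _ (Λ.d l) p q)
  rw [e2, InfPath.shift_concat] at e3
  exact (fibre_antisymm_shift hcof hσ x n p q).trans e3.symm

theorem IsPartition.exists_bicharacter (hP : Λ.IsPartition P)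
    (hrow : Λ.RowFiniteNoSources) (hcof : Λ.IsCofinal) {c : Λ.Pairs → Circle}
    (hcc : Λ.IsCocycle c) :
    ∃ ω : Λ.per → Λ.per → Circle, IsBicharacter ω ∧
      ∀ x, (SmallCat.ofAddGroup Λ.per).Cohomologous
        (groupCochain (fibre hcof (Λ.sigmaC P c) x)) (groupCochain ω) := by
  have := AddSubgroup.free_int_of_pi Λ.per
  have := AddSubgroup.finite_int_of_pi Λ.per
  have hσ := hP.isCocycle_sigmaC hcc
  rcases isEmpty_or_nonempty Λ.InfPath with he | ⟨⟨x₀⟩⟩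
  · exact ⟨fun _ _ => 1, ⟨fun _ _ _ => (mul_one 1).symm, fun _ _ _ => (mul_one 1).symm⟩,
      fun x => he.elim x⟩
  -- Only the antisymmetrisation at `x₀` enters; it is the same at every `x`, so ω differs from each
  -- fibre by a symmetric cocycle.
  obtain ⟨ω, hω⟩ := (isAddCocycle_fibre hcof hσ x₀).exists_bilin
  refine ⟨fun p q => (ω p q).toMul, ⟨fun p p' q => ?_, fun p q q' => ?_⟩, fun x => ?_⟩
  · simp only [map_add, LinearMap.add_apply, toMul_add]
  · simp only [map_add, toMul_add]
  · rw [cohomologous_groupCochain_iff]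
    have hsub := (IsAddCocycle.of_bilin ω).sub (isAddCocycle_fibre hcof hσ x)
    obtain ⟨b, hb, hb'⟩ := hsub.exists_eq_coboundary (fun p q => by
      have h1 := hω p q
      have h2 : _ = _ := congrArg Additive.ofMul (hP.fibre_antisymm_eq hrow hcof hcc x x₀ p q)
      simp only [ofMul_mul, ofMul_inv] at h2
      grind)
    refine ⟨fun p => (b p).toMul, hb, fun p q => ?_⟩
    have h := congrArg Additive.toMul (hb' p q)
    simp only [toMul_add, toMul_sub, toMul_ofMul] at h
    rw [mul_comm, ← div_eq_mul_inv, ← div_eq_mul_inv, h]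

/-! ### Straightening σ_c on the interior of the isotropy -/

/-- The extension by `1` of a function on the interior `{(x, p, x)}` of the isotropy. -/
noncomputable def extendOne (β : Λ.per → Λ.InfPath → Circle) (g : Λ.gpd.Mor) : Circle :=
  open Classical in
  if h : Gpd.deg g ∈ Λ.per ∧ g ∈ Λ.isotropyInterior then β ⟨Gpd.deg g, h.1⟩ (Gpd.fst g) else 1

theorem extendOne_isoElt (hrow : Λ.RowFiniteNoSources) (hcof : Λ.IsCofinal)
    (β : Λ.per → Λ.InfPath → Circle) (x : Λ.InfPath) (p : Λ.per) :
    extendOne β (isoElt hcof x p) = β p x :=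
  dif_pos ⟨p.2, isoElt_mem_isotropyInterior hrow hcof x p⟩

theorem extendOne_of_notMem (β : Λ.per → Λ.InfPath → Circle) {g : Λ.gpd.Mor}
    (hg : g ∉ Λ.isotropyInterior) : extendOne β g = 1 :=
  dif_neg fun h => hg h.2

/-- The interior of the isotropy is open and closed, and on a cylinder the middle entry `p` is
fixed, leaving only the locally constant `β p`. -/
theorem continuous_extendOne (hrow : Λ.RowFiniteNoSources) (hcof : Λ.IsCofinal)
    {β : Λ.per → Λ.InfPath → Circle} (hβ : ∀ p, β p ∈ Λ.locallyConstant) :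
    Continuous (extendOne β) := by
  apply continuous_of_locally_eq
  intro g
  by_cases hg : g ∈ Λ.isotropyInterior
  · obtain ⟨x, p, rfl⟩ := eq_isoElt_of_mem_isotropyInterior hcof hg
    obtain ⟨m, n, hrep⟩ := Gpd.exists_rep (isoElt hcof x p)
    obtain ⟨N, hN⟩ := hβ p x
    refine ⟨Λ.isotropyInterior ∩ cyl (isoElt hcof x p) (m + N) (n + N),
      isOpen_interior.inter (isOpen_cyl (hrep.add N)), ⟨hg, self_mem_cyl (hrep.add N)⟩, ?_⟩
    rintro g' ⟨h1, h2⟩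
    obtain ⟨x', p', rfl⟩ := eq_isoElt_of_mem_isotropyInterior hcof h1
    obtain ⟨h3, -, h4⟩ := mem_cyl.1 h2
    obtain rfl : p' = p := Subtype.ext (h4.deg.trans (hrep.add N).deg.symm)
    rw [extendOne_isoElt hrow, extendOne_isoElt hrow]
    exact hN _ (InfPath.initSeg_mono le_add_self h3)
  · refine ⟨_, (isClosed_isotropyInterior hrow hcof).isOpen_compl, hg, fun g' hg' => ?_⟩
    rw [extendOne_of_notMem β hg, extendOne_of_notMem β hg']

theorem IsPartition.exists_cocycle (hP : Λ.IsPartition P)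
    (hrow : Λ.RowFiniteNoSources) (hcof : Λ.IsCofinal) {c : Λ.Pairs → Circle}
    (hcc : Λ.IsCocycle c) {ω : Λ.per → Λ.per → Circle} (hω : IsBicharacter ω)
    (hcoh : ∀ x, (SmallCat.ofAddGroup Λ.per).Cohomologous
      (groupCochain (fibre hcof (Λ.sigmaC P c) x)) (groupCochain ω)) :
    ∃ σ : Λ.gpd.Pairs → Circle, Λ.gpd.IsCocycle σ ∧ Continuous σ ∧
      Λ.gpd.ContCohomologous σ (Λ.sigmaC P c) ∧ ∀ x p q, σ (isoPair hcof x p q) = ω p q := by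
  have := AddSubgroup.free_int_of_pi Λ.per
  have hσ := hP.isCocycle_sigmaC hcc
  -- Viewing all fibres at once as a cocycle with values in locally constant functions makes the
  -- splitting produce a cochain that is locally constant in `x`.
  let F : Λ.per → Λ.per → Additive Λ.locallyConstant := fun p q => Additive.ofMul
    ⟨fun x => ω p q * (fibre hcof (Λ.sigmaC P c) x p q)⁻¹,
      mul_mem (fun _ => ⟨0, fun _ _ => rfl⟩)
        (inv_mem (hP.fibre_mem_locallyConstant hrow hcof hcc p q))⟩
  have hx : ∀ x, IsAddCocycle fun p q =>
      Additive.ofMul (ω p q * (fibre hcof (Λ.sigmaC P c) x p q)⁻¹) := fun x => by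
    have h := hω.isAddCocycle.sub (isAddCocycle_fibre hcof hσ x)
    simpa only [sub_eq_add_neg, ← ofMul_inv, ← ofMul_mul] using h
  have hF : IsAddCocycle F :=
    { zero_left := fun p => Subtype.ext (funext fun x => (hx x).zero_left p)
      zero_right := fun p => Subtype.ext (funext fun x => (hx x).zero_right p)
      cocycle := fun p q t => Subtype.ext (funext fun x => (hx x).cocycle p q t) }
  have hsymm : ∀ p q, F p q = F q p := by
    intro p q
    refine Subtype.ext (funext fun x => ?_)
    obtain ⟨b, -, hb⟩ := cohomologous_groupCochain_iff.1 (hcoh x)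
    change ω p q * (fibre hcof (Λ.sigmaC P c) x p q)⁻¹ =
      ω q p * (fibre hcof (Λ.sigmaC P c) x q p)⁻¹
    -- A coboundary on an abelian group is symmetric, so pointwise cohomology suffices here; how `b`
    -- depends on `x` is irrelevant.
    rw [mul_comm, hb, mul_comm (ω q p), hb, mul_comm (b p), add_comm p]
  obtain ⟨B, hB0, hB⟩ := hF.exists_eq_coboundary hsymm
  let β : Λ.per → Λ.InfPath → Circle := fun p => (B p).toMul.1
  have hβ0 : ∀ x, β 0 x = 1 := fun x => by
    simp only [β, hB0]
    rfl
  have hβ : ∀ p q x, ω p q * (fibre hcof (Λ.sigmaC P c) x p q)⁻¹ =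
      β p x * β q x * (β (p + q) x)⁻¹ := by
    intro p q x
    rw [← div_eq_mul_inv (β p x * β q x)]
    exact congrFun (congrArg (fun m : Additive Λ.locallyConstant => m.toMul.1) (hB p q)) x
  have hb1 : ∀ x : Λ.gpd.Obj, extendOne β (Λ.gpd.one x) = 1 := fun x =>
    (extendOne_isoElt hrow hcof β x 0).trans (hβ0 x)
  have hbc : Continuous (extendOne β) :=
    continuous_extendOne hrow hcof fun p => (B p).toMul.2
  have hcob : Continuous (Λ.gpd.coboundary (extendOne β)) :=
    ((hbc.comp (continuous_fst.comp continuous_subtype_val)).mul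
      (hbc.comp (continuous_snd.comp continuous_subtype_val))).mul
      (hbc.comp continuous_comp).inv
  refine ⟨fun p => Λ.sigmaC P c p * Λ.gpd.coboundary (extendOne β) p,
    hσ.mul (SmallCat.isCocycle_coboundary hb1), (hP.continuous_sigmaC hcc).mul hcob,
    -- The inverse appears because the relation is read from σ back to σ_c.
    ⟨fun g => (extendOne β g)⁻¹, hbc.inv, fun v => inv_eq_one.2 (hb1 v), fun p => ?_⟩,
    fun x p q => ?_⟩
  · simp only [SmallCat.coboundary]
    apply_fun Additive.ofMul using Additive.ofMul.injective
    simp only [ofMul_mul, ofMul_inv]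
    abel
  · have h : Λ.gpd.coboundary (extendOne β) (isoPair hcof x p q) =
        β p x * β q x * (β (p + q) x)⁻¹ := by
      rw [← extendOne_isoElt hrow hcof β x p, ← extendOne_isoElt hrow hcof β x q,
        ← extendOne_isoElt hrow hcof β x (p + q)]
      rfl
    change fibre hcof (Λ.sigmaC P c) x p q * _ = _
    rw [h, ← hβ, mul_comm, inv_mul_cancel_right]

end Partition

end KGraph

theorem proposition3p1 {k : ℕ} (Λ : KGraph.{u} k) (hrow : Λ.RowFiniteNoSources)
    (hcof : Λ.IsCofinal) (c : Λ.Pairs → Circle) (hc : Λ.IsCocycle c)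
    (P : Set (Λ.Mor × Λ.Mor)) (hP : Λ.IsPartition P) :
    -- the value of `σ_c` at a composable pair exists and is independent of all choices
    (∀ gh, Nonempty (Λ.Alignment P gh) ∧
      ∀ A : Λ.Alignment P gh, Λ.sigmaC P c gh = A.value c) ∧
    -- `σ_c` is a continuous 2-cocycle on the groupoid, and its fibres are 2-cocycles
    (Λ.gpd.IsCocycle (Λ.sigmaC P c) ∧ Continuous (Λ.sigmaC P c)) ∧
    (∀ x, (SmallCat.ofAddGroup Λ.per).IsCocycle
      (groupCochain (KGraph.fibre hcof (Λ.sigmaC P c) x))) ∧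
    -- one bicharacter is cohomologous to all of the fibres
    (∃ ω : Λ.per → Λ.per → Circle, IsBicharacter ω ∧
      ∀ x, (SmallCat.ofAddGroup Λ.per).Cohomologous
        (groupCochain (KGraph.fibre hcof (Λ.sigmaC P c) x)) (groupCochain ω)) ∧
    -- the interior of the isotropy is `{(x, p, x) : x ∈ Λ^∞, p ∈ Per(Λ)}`
    (Λ.isotropyInterior = {g | ∃ x p, g = KGraph.isoElt hcof x p}) ∧
    -- for every such bicharacter, `σ_c` is cohomologous to some `σ` restricting to it
    (∀ ω : Λ.per → Λ.per → Circle, IsBicharacter ω →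
      (∀ x, (SmallCat.ofAddGroup Λ.per).Cohomologous
        (groupCochain (KGraph.fibre hcof (Λ.sigmaC P c) x)) (groupCochain ω)) →
      ∃ σ : Λ.gpd.Pairs → Circle, Λ.gpd.IsCocycle σ ∧ Continuous σ ∧
        Λ.gpd.ContCohomologous σ (Λ.sigmaC P c) ∧
        ∀ x p q, σ (KGraph.isoPair hcof x p q) = ω p q) := by
  have hσ := hP.isCocycle_sigmaC hc
  exact ⟨fun gh => ⟨hP.nonempty_alignment gh, fun A => hP.sigmaC_eq_value hc A⟩,
    ⟨hσ, hP.continuous_sigmaC hc⟩,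
    fun x => isCocycle_groupCochain (KGraph.isAddCocycle_fibre hcof hσ x),
    hP.exists_bicharacter hrow hcof hc, KGraph.isotropyInterior_eq hrow hcof,
    fun ω hω hcoh => hP.exists_cocycle hrow hcof hc hω hcoh⟩
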